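/- Identify the plane with $\mathbb{C}$ and $\mathbb{Z}^2$ with $\{a+bi : a,b\in\mathbb{Z}\}$. For a finite set $P$ of points in the plane let $S_\triangle(P)$ be the number of three-element subsets of $P$ that are the vertices of an isosceles right triangle. For a set $K$ and a point $z$ let $R_{\pi/2}(z,K)$ be the image of $K$ under the counterclockwise rotation by $\pi/2$ about $z$, and put $f_K(z)=\mathrm{Area}(K\cap R_{\pi/2}(z,K))$. Let $K\subset\mathbb{C}$ be a compact set of area $1$ with finite perimeter, where the perimeter is the (upper Minkowski) length of the boundary, $\limsup_{\delta\to0^+}\frac{1}{2\delta}\mathrm{Area}\{w : \mathrm{dist}(w,\partial K)\le\delta\}$. Then $f_K$ is integrable on $K$, and there is a constant $C$, depending only on $K$, such that for every $n\ge 0$ and every similar copy $K_n$ of $K$ (the image of $K$ under a similarity of the plane, possibly orientation reversing) that contains exactly $n$ points of $\mathbb{Z}^2$, $$\left|S_\triangle(K_n\cap\mathbb{Z}^2)-\left(\int_K f_K(z)\,dz\right)n^2\right|\le C\,n^{3/2},$$ that is, $S_\triangle(K_n\cap\mathbb{Z}^2)=\left(\int_K f_K\right)n^2+O(n^{3/2})$.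 In particular, for the square $K=\{x+iy : |x|\le\frac12,\ |y|\le\frac12\}$ of area $1$ one has $\int_K f_K=\frac{5}{12}$ and $S_\triangle(K_n\cap\mathbb{Z}^2)=\frac{5}{12}n^2+O(n^{3/2})$, and for the disk $K=\{z : |z|\le 1/\sqrt{\pi}\}$ of area $1$ one has $\int_K f_K=\frac34-\frac1\pi$ and $S_\triangle(K_n\cap\mathbb{Z}^2)=\left(\frac34-\frac1\pi\right)n^2+O(n^{3/2})$, in the same sense. -/

import Mathlib

open MeasureTheory Set Filter Topology

noncomputable section

/-- The integer lattice `ℤ²`, generated by `(1,0)` and `(0,1)`, in the plane `ℂ`. -/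
def latticeZ2 : Set ℂ := {z | ∃ a b : ℤ, z = (a : ℂ) + (b : ℂ) * Complex.I}

/-- The perimeter of a plane set, i.e. the length of its topological boundary in the sense of
Minkowski: the upper limit, as `δ → 0⁺`, of the area of the `δ`-neighbourhood of the boundary
divided by `2 δ`.  (For a boundary made of finitely many rectifiable curves this is its length.) -/
def perimeter (K : Set ℂ) : ENNReal :=
  limsup (fun δ : ℝ => volume (Metric.cthickening δ (frontier K)) / ENNReal.ofReal (2 * δ))
    (𝓝[>] 0)

/-- The image of `P` under the counterclockwise rotation by `π / 2` with centre `z`. -/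
def rotQuarter (z : ℂ) (P : Set ℂ) : Set ℂ := (fun w => z + Complex.I * (w - z)) '' P

/-- `f_K(z) = Area (K ∩ R_{π/2}(z, K))`. -/
def overlapArea (K : Set ℂ) (z : ℂ) : ℝ := (volume (K ∩ rotQuarter z K)).toReal

/-- `T` is the vertex set of a (nondegenerate) isosceles right triangle; `a` is the vertex at the
right angle. -/
def IsIsoscelesRight (T : Finset ℂ) : Prop :=
  ∃ a b c : ℂ, T = {a, b, c} ∧ b ≠ a ∧ dist a b = dist a c ∧
    EuclideanGeometry.angle b a c = Real.pi / 2

/-- The number of triplets in `P` that are the vertices of an isosceles right triangle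
(used for finite `P`). -/
def numIsoscelesRight (P : Set ℂ) : ℕ :=
  {T : Finset ℂ | (T : Set ℂ) ⊆ P ∧ IsIsoscelesRight T}.ncard

/-- `L` is the image of `K` under a similarity of the plane, orientation preserving or
orientation reversing. -/
def IsSimilarCopy (K L : Set ℂ) : Prop :=
  ∃ a b : ℂ, a ≠ 0 ∧
    (L = (fun w => a * w + b) '' K ∨ L = (fun w => a * starRingEnd ℂ w + b) '' K)

/-- Every similar copy `L` of `K` that contains exactly `n` lattice points has
`c * n ^ 2 + O(n ^ (3 / 2))` isosceles right triangles among these lattice points;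
the implied constant does not depend on `n` and `L`. -/
def TriangleAsymptotics (K : Set ℂ) (c : ℝ) : Prop :=
  ∃ C : ℝ, ∀ (n : ℕ) (L : Set ℂ), IsSimilarCopy K L → (L ∩ latticeZ2).ncard = n →
    |(numIsoscelesRight (L ∩ latticeZ2) : ℝ) - c * (n : ℝ) ^ 2| ≤ C * (n : ℝ) ^ (3 / 2 : ℝ)

/-- The square of area `1` with centre `0` and sides parallel to the axes. -/
def unitAreaSquare : Set ℂ := {z | |z.re| ≤ 1 / 2 ∧ |z.im| ≤ 1 / 2}

/-- The closed disk of area `1` with centre `0`. -/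
def unitAreaDisk : Set ℂ := {z | ‖z‖ ≤ 1 / Real.sqrt Real.pi}

end

/-! Fix a direction `s = ±I`. An isosceles right triangle is the same thing as an ordered pair
(right-angle vertex `p`, second vertex `q ≠ p`), the third vertex being `p + s * (q - p)`; exactly
one of the two legs can play the role of `q`. So the triangle count plus the number of degenerate
pairs `q = p` is a sum over `p` of the number of `q` with `q` and its quarter turn both in the set
(`numIsoscelesRight_add_card`).

Quarter turns about a lattice point preserve ℤ², so for a copy `φ '' K` of ratio `r` the inner
number counts lattice points in `φ '' (K ∩ rotQuarter z K)`, where `φ z = p`. Lattice points are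
counted by area: each carries a unit square, and pulling the floor map back through `φ` moves points
of the plane by at most `2 / r`. A count therefore differs from `r ^ 2` times an area by at most `r
^ 2` times the area of neighbourhoods of the boundary of width of order `1 / r`. Finite perimeter
makes that area `O(1 / r)`. The same comparison turns the sum of `overlapArea K` over lattice points
into `r ^ 2` times its integral, because `overlapArea K` itself varies by at most the area of such a
neighbourhood.

Altogether the count is `r ^ 4 * ∫ f_K + O(r ^ 3)` and `n = r ^ 2 + O(r)`, which gives the error
`O(n ^ (3 / 2))` for large `r` (`abs_num_sub_le`, `abs_sub_mul_sq_le`). For small `r` the number `n`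
is bounded and the trivial bound `n ^ 2` suffices. The square and the disk then only require
explicit integrals. -/

/-! ### Isosceles right triangles as pairs of points -/

/-- A nondegenerate isosceles right triangle consists of its right-angle vertex `a`, a second vertex
`b`, and the image of `b` under a quarter turn about `a` in any prescribed direction `s`. -/
lemma isIsoscelesRight_iff {s : ℂ} (hs : s = Complex.I ∨ s = -Complex.I) (T : Finset ℂ) :
    IsIsoscelesRight T ↔ ∃ a b : ℂ, b ≠ a ∧ T = {a, b, a + s * (b - a)} := by
  have key : ∀ a b c : ℂ, b ≠ a → dist a b = dist a c →
      EuclideanGeometry.angle b a c = Real.pi / 2 →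
      c = a + Complex.I * (b - a) ∨ c = a - Complex.I * (b - a) := by
    intro a b c hab hd h
    have h1 : inner ℝ (b - a) (c - a) = (0 : ℝ) := by
      rw [InnerProductGeometry.inner_eq_zero_iff_angle_eq_pi_div_two]
      simpa [EuclideanGeometry.angle] using h
    have h2 : Complex.normSq (b - a) = Complex.normSq (c - a) := by
      rw [dist_comm a b, dist_comm a c, dist_eq_norm, dist_eq_norm] at hd
      rw [Complex.normSq_eq_norm_sq, Complex.normSq_eq_norm_sq, hd]
    have hab' : b - a ≠ 0 := sub_ne_zero.2 hab
    -- Squaring removes the choice of sign: the difference of the two sides factors into the two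
    -- possible equations for `c`.
    have h3 : (c - a) ^ 2 = -(b - a) ^ 2 := by
      rw [Complex.inner] at h1
      generalize b - a = u at *
      generalize c - a = v at *
      simp [Complex.normSq_apply] at h1 h2
      have hpos : 0 < Complex.normSq u := Complex.normSq_pos.2 hab'
      rw [Complex.normSq_apply] at hpos
      have e : (u.re ^ 2 + u.im ^ 2) * (v.im ^ 2 - u.re ^ 2) = 0 := by
        linear_combination (-u.re^2) * h2 + (-u.re * v.re + u.im * v.im) * h1
      have e1 : v.im ^ 2 = u.re ^ 2 := by
        rcases mul_eq_zero.1 e with e | e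
        · nlinarith
        · linarith
      have e2 : v.re ^ 2 = u.im ^ 2 := by linarith
      have e3 : (v.re * v.im + u.re * u.im) * (u.re ^ 2 + u.im ^ 2) = 0 := by
        linear_combination (v.re * u.im + u.re * v.im) * h1 - (u.re * u.im) * (e1 + e2) + 0 * h2
      apply Complex.ext
      · simp [sq]; nlinarith
      · have : v.re * v.im + u.re * u.im = 0 := by
          rcases mul_eq_zero.1 e3 with e | e
          · exact e
          · nlinarith
        simp [sq]; linarith
    have h4 : (c - a - Complex.I * (b - a)) * (c - a + Complex.I * (b - a)) = 0 := by
      linear_combination h3 - (b - a) ^ 2 * Complex.I_sq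
    rcases mul_eq_zero.1 h4 with h | h
    · left; linear_combination h
    · right; linear_combination h
  constructor
  · rintro ⟨a, b, c, rfl, hab, hd, hang⟩
    -- If the turn from `b` to `c` has the wrong sense, exchanging `b` and `c` corrects it.
    have hc : c = a + s * (b - a) ∨ b = a + s * (c - a) := by
      rcases hs with rfl | rfl <;> rcases key a b c hab hd hang with h | h
      · left; exact h
      · right; rw [h]; linear_combination (b - a) * Complex.I_sq
      · right; rw [h]; linear_combination (b - a) * Complex.I_sq
      · left; rw [h]; ring
    rcases hc with h | h
    · exact ⟨a, b, hab, by rw [← h]⟩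
    · refine ⟨a, c, ?_, by rw [← h, Finset.pair_comm]⟩
      rintro rfl
      apply hab
      simpa using h
  · rintro ⟨a, b, hab, rfl⟩
    refine ⟨a, b, _, rfl, hab, ?_, ?_⟩
    · have : ‖s‖ = 1 := by rcases hs with rfl | rfl <;> simp
      rw [dist_comm a b, dist_comm a, dist_eq_norm, dist_eq_norm]
      simp [this]
    · rw [EuclideanGeometry.angle, ← InnerProductGeometry.inner_eq_zero_iff_angle_eq_pi_div_two,
        Complex.inner]
      rcases hs with rfl | rfl <;> simp <;> ring

/-- The right-angle vertex and the orientation of an isosceles right triangle are determined by its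
vertex set. -/
lemma isoscelesRight_vertices_injective {s : ℂ} (hs : s = Complex.I ∨ s = -Complex.I)
    {a b a' b' : ℂ} (hab : b ≠ a) (hab' : b' ≠ a')
    (h : ({a, b, a + s * (b - a)} : Finset ℂ) = {a', b', a' + s * (b' - a')}) :
    a = a' ∧ b = b' := by
  have hs2 : s * s = -1 := by rcases hs with rfl | rfl <;> simp
  have hu : b - a ≠ 0 := sub_ne_zero.2 hab
  have s0 : s ≠ 0 := by rintro rfl; simp at hs2
  have s1 : s - 1 ≠ 0 := by
    intro e
    have : s = 1 := by linear_combination e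
    rw [this] at hs2; norm_num at hs2
  have s2 : s + 1 ≠ 0 := by
    intro e
    have : s = -1 := by linear_combination e
    rw [this] at hs2; norm_num at hs2
  have s3 : 2 * s + 1 ≠ 0 := by
    intro e
    have : s = -1 / 2 := by linear_combination e / 2
    rw [this] at hs2; norm_num at hs2
  have s4 : 2 * s - 1 ≠ 0 := by
    intro e
    have : s = 1 / 2 := by linear_combination e / 2
    rw [this] at hs2; norm_num at hs2
  have m1 : a' ∈ ({a, b, a + s * (b - a)} : Finset ℂ) := by rw [h]; simp
  have m2 : b' ∈ ({a, b, a + s * (b - a)} : Finset ℂ) := by rw [h]; simp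
  have m3 : a' + s * (b' - a') ∈ ({a, b, a + s * (b - a)} : Finset ℂ) := by rw [h]; simp
  simp only [Finset.mem_insert, Finset.mem_singleton] at m1 m2 m3
  obtain ⟨u, rfl⟩ : ∃ u, b = a + u := ⟨b - a, by ring⟩
  simp only [add_sub_cancel_left] at *
  -- Every wrong matching of the vertices forces `t * u = 0` for the leg `u` and some `t` that is
  -- nonzero because `s * s = -1`.
  have bad : ∀ t : ℂ, t ≠ 0 → t * u = 0 → False := fun t ht e => by
    rcases mul_eq_zero.1 e with e | e
    · exact ht e
    · exact hu e
  have hsu : s * s * u = -u := by rw [hs2]; ring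
  rcases m1 with rfl | rfl | rfl
  · rcases m2 with rfl | rfl | rfl
    · exact absurd rfl hab'
    · exact ⟨rfl, rfl⟩
    · exfalso
      rcases m3 with e | e | e
      · exact bad 1 one_ne_zero (by linear_combination hsu - e)
      · exact bad 2 two_ne_zero (by linear_combination hsu - e)
      · exact bad _ s2 (by linear_combination hsu - e)
  · exfalso
    rcases m2 with rfl | rfl | rfl
    · rcases m3 with e | e | e
      · exact bad _ s1 (by linear_combination -e)
      · exact bad _ s0 (by linear_combination -e)
      · exact bad _ s4 (by linear_combination -e)
    · exact absurd rfl hab'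
    · rcases m3 with e | e | e
      · exact bad _ s0 (by linear_combination hsu - e)
      · exact bad _ s2 (by linear_combination hsu - e)
      · exact bad _ s0 (by linear_combination (hsu - e) / 2)
  · exfalso
    rcases m2 with rfl | rfl | rfl
    · rcases m3 with e | e | e
      · exact bad _ s2 (by linear_combination hsu + e)
      · exact bad _ s0 (by linear_combination hsu + e)
      · exact bad 1 one_ne_zero (by linear_combination hsu + e)
    · rcases m3 with e | e | e
      · exact bad _ s3 (by linear_combination hsu + e)
      · exact bad _ s0 (by linear_combination (hsu + e) / 2)
      · exact bad _ s2 (by linear_combination hsu + e)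
    · exact absurd rfl hab'

/-- Isosceles right triangles in a finite set are counted by their right-angle vertex together with
a second vertex; the degenerate pairs account for the additional summand `P.card`. -/
lemma numIsoscelesRight_add_card {s : ℂ} (hs : s = Complex.I ∨ s = -Complex.I) (P : Finset ℂ) :
    numIsoscelesRight (P : Set ℂ) + P.card =
      ∑ p ∈ P, (P.filter fun q => p + s * (q - p) ∈ P).card := by
  classical
  have h1 : numIsoscelesRight (P : Set ℂ) =
      (((P ×ˢ P).filter fun x => x.2 ≠ x.1 ∧ x.1 + s * (x.2 - x.1) ∈ P)).card := by
    have hset : {T : Finset ℂ | (T : Set ℂ) ⊆ (P : Set ℂ) ∧ IsIsoscelesRight T} =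
        (((P ×ˢ P).filter fun x => x.2 ≠ x.1 ∧ x.1 + s * (x.2 - x.1) ∈ P).image
          fun x : ℂ × ℂ => ({x.1, x.2, x.1 + s * (x.2 - x.1)} : Finset ℂ) : Finset (Finset ℂ)) := by
      ext T
      simp only [mem_ofPred_eq, isIsoscelesRight_iff hs, Finset.coe_image, Set.mem_image,
        Finset.coe_filter, Finset.mem_product, Finset.coe_subset]
      constructor
      · rintro ⟨hT, a, b, hab, rfl⟩
        exact ⟨(a, b), ⟨⟨hT (by simp), hT (by simp)⟩, hab, hT (by simp)⟩, rfl⟩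
      · rintro ⟨⟨a, b⟩, ⟨⟨ha, hb⟩, hab, hc⟩, rfl⟩
        refine ⟨?_, a, b, hab, rfl⟩
        intro x hx
        simp only [Finset.mem_insert, Finset.mem_singleton] at hx
        rcases hx with rfl | rfl | rfl <;> assumption
    rw [numIsoscelesRight, hset, Set.ncard_coe_finset, Finset.card_image_of_injOn]
    rintro ⟨a, b⟩ h ⟨a', b'⟩ h' e
    simp only [Finset.coe_filter, mem_ofPred_eq] at h h'
    obtain ⟨e1, e2⟩ := isoscelesRight_vertices_injective hs h.2.1 h'.2.1 e
    exact Prod.ext e1 e2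
  have h2 : ∀ p ∈ P, (P.filter fun q => p + s * (q - p) ∈ P).card =
      (P.filter fun q => q ≠ p ∧ p + s * (q - p) ∈ P).card + 1 := by
    intro p hp
    rw [← Finset.card_insert_of_notMem (a := p) (by simp)]
    congr 1
    ext q
    simp only [Finset.mem_filter, Finset.mem_insert]
    by_cases h : q = p
    · subst h; simp [hp]
    · simp [h]
  rw [h1, Finset.sum_congr rfl h2, Finset.sum_add_distrib, Finset.card_filter,
    Finset.sum_product]
  simp only [← Finset.card_filter, Finset.sum_const, smul_eq_mul, mul_one]

/-- This crude bound handles the copies of small ratio, where no area estimate is available. -/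
lemma numIsoscelesRight_le_sq (P : Finset ℂ) : numIsoscelesRight (P : Set ℂ) ≤ P.card ^ 2 := by
  have h := numIsoscelesRight_add_card (Or.inl rfl) P
  have : ∑ p ∈ P, (P.filter fun q => p + Complex.I * (q - p) ∈ P).card ≤ ∑ p ∈ P, P.card :=
    Finset.sum_le_sum fun p _ => Finset.card_filter_le _ _
  rw [Finset.sum_const, smul_eq_mul] at this
  nlinarith

/-! ### Lattice squares -/

/-- The lower left corner of the lattice square containing a point of the plane. -/
noncomputable def latticeFloor (z : ℂ) : ℂ := (⌊z.re⌋ : ℂ) + (⌊z.im⌋ : ℂ) * Complex.I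

lemma latticeFloor_mem (z : ℂ) : latticeFloor z ∈ latticeZ2 := ⟨_, _, rfl⟩

lemma dist_latticeFloor_le (z : ℂ) : dist (latticeFloor z) z ≤ 2 := by
  rw [dist_eq_norm]
  refine (Complex.norm_le_abs_re_add_abs_im _).trans ?_
  have h1 := Int.floor_le z.re
  have h2 := Int.lt_floor_add_one z.re
  have h3 := Int.floor_le z.im
  have h4 := Int.lt_floor_add_one z.im
  have e1 : |(latticeFloor z - z).re| ≤ 1 := by
    simp [latticeFloor]; rw [abs_le]; constructor <;> linarith
  have e2 : |(latticeFloor z - z).im| ≤ 1 := by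
    simp [latticeFloor]; rw [abs_le]; constructor <;> linarith
  linarith

lemma measurable_latticeFloor : Measurable latticeFloor := by
  unfold latticeFloor
  fun_prop

lemma volume_reProdIm (s t : Set ℝ) : volume (s ×ℂ t) = volume s * volume t := by
  rw [← Measure.prod_prod, ← Measure.volume_eq_prod,
    ← Complex.volume_preserving_equiv_real_prod.measure_preimage_equiv]
  congr 1

lemma volume_latticeFloor_fiber {p : ℂ} (hp : p ∈ latticeZ2) :
    volume (latticeFloor ⁻¹' {p}) = 1 := by
  obtain ⟨a, b, rfl⟩ := hp
  have : latticeFloor ⁻¹' {(a : ℂ) + (b : ℂ) * Complex.I} =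
      Ico (a : ℝ) (a + 1) ×ℂ Ico (b : ℝ) (b + 1) := by
    ext z
    simp only [mem_preimage, mem_singleton_iff, Complex.mem_reProdIm, mem_Ico, ← Int.floor_eq_iff]
    rw [latticeFloor, Complex.ext_iff]
    simp
  rw [this, volume_reProdIm]
  simp

lemma finite_inter_latticeZ2 {L : Set ℂ} (hL : Bornology.IsBounded L) :
    (L ∩ latticeZ2).Finite := by
  obtain ⟨R, hR⟩ := hL.subset_closedBall 0
  have : L ∩ latticeZ2 ⊆ (fun x : ℤ × ℤ => (x.1 : ℂ) + (x.2 : ℂ) * Complex.I) ''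
      (Icc (-⌈R⌉) ⌈R⌉ ×ˢ Icc (-⌈R⌉) ⌈R⌉) := by
    rintro z ⟨hz, a, b, rfl⟩
    have h := hR hz
    rw [mem_closedBall_zero_iff] at h
    have h1 := (Complex.abs_re_le_norm _).trans h
    have h2 := (Complex.abs_im_le_norm _).trans h
    simp at h1 h2
    refine ⟨(a, b), ⟨?_, ?_⟩, rfl⟩
    · have h3 := abs_le.1 (h1.trans (Int.le_ceil R))
      exact ⟨by exact_mod_cast h3.1, by exact_mod_cast h3.2⟩
    · have h3 := abs_le.1 (h2.trans (Int.le_ceil R))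
      exact ⟨by exact_mod_cast h3.1, by exact_mod_cast h3.2⟩
  exact ((finite_Icc _ _).prod (finite_Icc _ _)).image _ |>.subset this

/-! ### Similarities and counting lattice points by area -/

/-- A similarity of the plane with ratio `r` that turns quarter turns `-I` into quarter turns
`s`. -/
structure IsPlaneSimilarity (φ : ℂ ≃ ℂ) (r : ℝ) (s : ℂ) : Prop where
  pos : 0 < r
  dist_eq : ∀ z w, dist (φ z) (φ w) = r * dist z w
  dir : s = Complex.I ∨ s = -Complex.I
  turn : ∀ z w, φ (z - Complex.I * (w - z)) = φ z + s * (φ w - φ z)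
  volume_preimage : ∀ A, volume (φ ⁻¹' A) = ENNReal.ofReal ((r ^ 2)⁻¹) * volume A

lemma volume_preimage_mul {a : ℂ} (ha : a ≠ 0) (A : Set ℂ) :
    volume ((fun z => a * z) ⁻¹' A) = ENNReal.ofReal ((‖a‖ ^ 2)⁻¹) * volume A := by
  have hdet : LinearMap.det (LinearMap.mul ℝ ℂ a) = ‖a‖ ^ 2 := by
    have := Algebra.norm_complex_apply a
    rw [Complex.normSq_eq_norm_sq] at this
    rw [← this, Algebra.norm_apply]; rfl
  have := Measure.addHaar_preimage_linearMap (μ := (volume : Measure ℂ)) (f := LinearMap.mul ℝ ℂ a)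
    (by rw [hdet]; positivity) A
  rw [hdet, abs_of_nonneg (by positivity)] at this
  exact this

/-- Orientation decides the sense of the turn: `s = -I` for `a * w + b` and `s = I` for the
conjugated map. The turn `-I` is the relevant one in the source because `w ∈ rotQuarter z K` means
`z - I * (w - z) ∈ K`. -/
lemma IsSimilarCopy.exists_equiv {K L : Set ℂ} (h : IsSimilarCopy K L) :
    ∃ (φ : ℂ ≃ ℂ) (r : ℝ) (s : ℂ), IsPlaneSimilarity φ r s ∧ L = φ '' K := by
  obtain ⟨a, b, ha, h | h⟩ := h
  · refine ⟨(Equiv.mulLeft₀ a ha).trans (Equiv.addRight b), ‖a‖, -Complex.I,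
      ⟨norm_pos_iff.2 ha, ?_, Or.inr rfl, ?_, ?_⟩, h⟩
    · intro z w
      simp [dist_eq_norm, ← mul_sub]
    · intro z w
      simp; ring
    · intro A
      rw [Equiv.coe_trans, preimage_comp]
      have := volume_preimage_mul ha ((fun x => x + b) ⁻¹' A)
      rw [measure_preimage_add_right] at this
      exact this
  · refine ⟨((starRingAut (R := ℂ)).toEquiv.trans (Equiv.mulLeft₀ a ha)).trans (Equiv.addRight b),
      ‖a‖, Complex.I, ⟨norm_pos_iff.2 ha, ?_, Or.inl rfl, ?_, ?_⟩, h⟩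
    · intro z w
      rw [dist_eq_norm, dist_eq_norm]
      change ‖(a * starRingEnd ℂ z + b) - (a * starRingEnd ℂ w + b)‖ = _
      rw [add_sub_add_right_eq_sub, ← mul_sub, norm_mul, ← map_sub, RCLike.norm_conj]
    · intro z w
      change a * starRingEnd ℂ _ + b = (a * starRingEnd ℂ z + b) + Complex.I *
        ((a * starRingEnd ℂ w + b) - (a * starRingEnd ℂ z + b))
      simp; ring
    · intro A
      have h1 := volume_preimage_mul ha ((fun x => x + b) ⁻¹' A)
      rw [measure_preimage_add_right] at h1
      have h2 := Complex.conjLIE.measurePreserving.measure_preimage_emb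
        Complex.conjLIE.toHomeomorph.measurableEmbedding
        ((fun z => a * z) ⁻¹' ((fun x => x + b) ⁻¹' A))
      rw [h1] at h2
      exact h2

namespace IsPlaneSimilarity

variable {φ : ℂ ≃ ℂ} {r : ℝ} {s : ℂ}

lemma continuous (h : IsPlaneSimilarity φ r s) : Continuous φ :=
  (LipschitzWith.of_dist_le_mul (K := ⟨r, h.pos.le⟩) fun z w => (h.dist_eq z w).le).continuous

lemma dist_symm_eq (h : IsPlaneSimilarity φ r s) (z w : ℂ) :
    dist (φ.symm z) (φ.symm w) = dist z w / r := by
  rw [eq_div_iff h.pos.ne', mul_comm, ← h.dist_eq]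
  simp

lemma dist_floor_le (h : IsPlaneSimilarity φ r s) (z : ℂ) :
    dist (φ.symm (latticeFloor (φ z))) z ≤ 2 / r := by
  conv_lhs => rw [← φ.symm_apply_apply z]
  rw [h.dist_symm_eq]
  gcongr
  · exact h.pos.le
  · simpa using dist_latticeFloor_le (φ z)

lemma measurable_floor (h : IsPlaneSimilarity φ r s) :
    Measurable fun z => latticeFloor (φ z) :=
  measurable_latticeFloor.comp h.continuous.measurable

lemma measurable_symm_floor (h : IsPlaneSimilarity φ r s) :
    Measurable fun z => φ.symm (latticeFloor (φ z)) := by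
  refine Measurable.comp (g := φ.symm) ?_ h.measurable_floor
  refine (LipschitzWith.of_dist_le_mul (K := ⟨r⁻¹, (inv_pos.2 h.pos).le⟩) fun z w => ?_).continuous.measurable
  rw [h.dist_symm_eq, div_eq_inv_mul]; rfl

lemma volume_fiber (h : IsPlaneSimilarity φ r s) {p : ℂ} (hp : p ∈ latticeZ2) :
    volume.real ((fun z => latticeFloor (φ z)) ⁻¹' {p}) = (r ^ 2)⁻¹ := by
  have := h.volume_preimage (latticeFloor ⁻¹' {p})
  rw [volume_latticeFloor_fiber hp, mul_one] at this
  rw [Measure.real, show ((fun z => latticeFloor (φ z)) ⁻¹' {p}) = φ ⁻¹' (latticeFloor ⁻¹' {p}) from rfl,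
    this, ENNReal.toReal_ofReal (by positivity)]

/-- A sum over lattice points is an integral of a function that is constant on lattice squares. -/
lemma sum_lattice_eq (h : IsPlaneSimilarity φ r s) {A : Set ℂ} {P : Finset ℂ}
    (hP : (P : Set ℂ) = φ '' A ∩ latticeZ2) (g : ℂ → ℝ) :
    Integrable (fun z => A.indicator g (φ.symm (latticeFloor (φ z)))) ∧
    ∑ p ∈ P, g (φ.symm p) =
      r ^ 2 * ∫ z, A.indicator g (φ.symm (latticeFloor (φ z))) := by
  have hmem : ∀ p, p ∈ P ↔ φ.symm p ∈ A ∧ p ∈ latticeZ2 := by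
    intro p
    rw [← Finset.mem_coe, hP, mem_inter_iff, Equiv.image_eq_preimage_symm]; rfl
  -- After composition with the floor map only finitely many values are nonzero, each on a preimage
  -- of a lattice square, so integrability needs no regularity of `g` or `A`.
  have hrw : (fun z => A.indicator g (φ.symm (latticeFloor (φ z)))) = fun z =>
      ∑ p ∈ P, ((fun z => latticeFloor (φ z)) ⁻¹' {p}).indicator (fun _ => g (φ.symm p)) z := by
    funext z
    by_cases hz : φ.symm (latticeFloor (φ z)) ∈ A
    · rw [Set.indicator_of_mem hz, Finset.sum_eq_single (latticeFloor (φ z))]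
      · simp
      · intro p _ hp
        rw [indicator_of_notMem]
        simpa using hp.symm
      · intro hn
        exact absurd ((hmem _).2 ⟨hz, latticeFloor_mem _⟩) hn
    · rw [Set.indicator_of_notMem hz]
      symm
      apply Finset.sum_eq_zero
      intro p hp
      rw [indicator_of_notMem]
      rintro rfl
      exact hz ((hmem _).1 hp).1
  have hmeas : ∀ p, MeasurableSet ((fun z => latticeFloor (φ z)) ⁻¹' {p}) := fun p =>
    h.measurable_floor (measurableSet_singleton p)
  have hint : ∀ p ∈ P, Integrable
      (((fun z => latticeFloor (φ z)) ⁻¹' {p}).indicator (fun _ => g (φ.symm p))) := by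
    intro p hp
    rw [integrable_indicator_iff (hmeas p)]
    refine integrableOn_const (fun hv => ?_) (by simp)
    have := h.volume_fiber ((hmem p).1 hp).2
    rw [Measure.real, hv, ENNReal.toReal_top] at this
    have hr := h.pos
    exact (by positivity : (r ^ 2)⁻¹ ≠ 0) this.symm
  rw [hrw]
  refine ⟨integrable_finsetSum _ hint, ?_⟩
  rw [integral_finsetSum _ hint, Finset.mul_sum]
  refine Finset.sum_congr rfl fun p hp => ?_
  rw [integral_indicator (hmeas p), setIntegral_const, h.volume_fiber ((hmem p).1 hp).2, smul_eq_mul]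
  have := h.pos
  field_simp

/-- The number of lattice points in a similar copy of `A`. -/
lemma card_lattice_eq (h : IsPlaneSimilarity φ r s) {A : Set ℂ} (hA : MeasurableSet A)
    {P : Finset ℂ} (hP : (P : Set ℂ) = φ '' A ∩ latticeZ2) :
    (P.card : ℝ) = r ^ 2 * volume.real ((fun z => φ.symm (latticeFloor (φ z))) ⁻¹' A) := by
  have := (h.sum_lattice_eq hP fun _ => 1).2
  simp only [Finset.sum_const, nsmul_eq_mul, mul_one] at this
  rw [this]
  congr 1
  rw [← integral_indicator_one (h.measurable_symm_floor hA)]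
  rfl

end IsPlaneSimilarity

/-! ### Neighbourhoods of the boundary and the overlap function -/

/-- The area of the closed `ε`-neighbourhood of the boundary of `K`. -/
noncomputable def frontierArea (K : Set ℂ) (ε : ℝ) : ℝ :=
  volume.real (Metric.cthickening ε (frontier K))

/-- A segment is connected, so one that joins a point of `A` to a point outside `A` meets the
frontier; the meeting point is within `ε` of both ends. -/
lemma mem_cthickening_frontier_and {A : Set ℂ} {z w : ℂ} (hz : z ∈ A) (hw : w ∉ A) {ε : ℝ}
    (h : dist z w ≤ ε) :
    z ∈ Metric.cthickening ε (frontier A) ∧ w ∈ Metric.cthickening ε (frontier A) := by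
  obtain ⟨y, hy, hyf⟩ : ∃ y ∈ segment ℝ z w, y ∈ frontier A := by
    by_contra! hcon
    have hsub : segment ℝ z w ⊆ interior A ∪ interior Aᶜ := by
      intro y hy
      by_contra hn
      rw [mem_union, not_or] at hn
      apply hcon y hy
      rw [frontier_eq_closure_inter_closure, closure_eq_compl_interior_compl,
        closure_eq_compl_interior_compl, compl_compl]
      exact ⟨hn.2, hn.1⟩
    obtain ⟨y, -, h1, h2⟩ := (convex_segment z w).isPreconnected _ _ isOpen_interior
      isOpen_interior hsub
      ⟨z, left_mem_segment ℝ z w, (hsub (left_mem_segment ℝ z w)).resolve_right fun h =>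
        interior_subset h hz⟩
      ⟨w, right_mem_segment ℝ z w, (hsub (right_mem_segment ℝ z w)).resolve_left fun h =>
        hw (interior_subset h)⟩
    exact interior_subset h2 (interior_subset h1)
  have hd := dist_add_dist_of_mem_segment hy
  refine ⟨Metric.mem_cthickening_of_dist_le _ y _ _ hyf ?_,
    Metric.mem_cthickening_of_dist_le _ y _ _ hyf ?_⟩
  · have := @dist_nonneg _ _ y w
    linarith
  · rw [dist_comm]
    have := @dist_nonneg _ _ z y
    linarith

lemma mem_cthickening_frontier_of_mem {A : Set ℂ} {z w : ℂ} {ε : ℝ} (hz : z ∈ A) (hw : w ∉ A)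
    (h : dist z w ≤ ε) : z ∈ Metric.cthickening ε (frontier A) :=
  (mem_cthickening_frontier_and hz hw h).1

lemma mem_cthickening_frontier_of_notMem {A : Set ℂ} {z w : ℂ} {ε : ℝ} (hz : z ∈ A) (hw : w ∉ A)
    (h : dist z w ≤ ε) : w ∈ Metric.cthickening ε (frontier A) :=
  (mem_cthickening_frontier_and hz hw h).2

/-- All area comparisons below have this shape, with `E` made of boundary neighbourhoods and their
rotations. -/
lemma abs_measureReal_sub_le {A B E : Set ℂ} (hA : volume A ≠ ⊤) (hB : volume B ≠ ⊤)
    (hE : volume E ≠ ⊤) (h1 : A ⊆ B ∪ E) (h2 : B ⊆ A ∪ E) :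
    |volume.real A - volume.real B| ≤ volume.real E := by
  have e1 := (measureReal_mono h1 (measure_union_ne_top hB hE)).trans
    (measureReal_union_le (μ := volume) B E)
  have e2 := (measureReal_mono h2 (measure_union_ne_top hA hE)).trans
    (measureReal_union_le (μ := volume) A E)
  rw [abs_le]
  constructor <;> linarith

lemma rotQuarter_eq_preimage (z : ℂ) (K : Set ℂ) :
    rotQuarter z K = (fun w => z - Complex.I * (w - z)) ⁻¹' K := by
  ext w
  constructor
  · rintro ⟨y, hy, rfl⟩
    have : z - Complex.I * (z + Complex.I * (y - z) - z) = y := by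
      linear_combination -(y - z) * Complex.I_sq
    rw [mem_preimage, this]; exact hy
  · intro hw
    exact ⟨_, hw, by linear_combination -(w - z) * Complex.I_sq⟩

lemma volume_rotQuarter (z : ℂ) (A : Set ℂ) : volume (rotQuarter z A) = volume A := by
  have h := volume_preimage_mul (a := -Complex.I) (by simp) ((fun x => x + (z + Complex.I * z)) ⁻¹' A)
  rw [measure_preimage_add_right] at h
  simp only [norm_neg, Complex.norm_I, one_pow, inv_one, ENNReal.ofReal_one, one_mul] at h
  rw [rotQuarter_eq_preimage, ← h]
  congr 1
  ext w
  simp only [mem_preimage]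
  ring_nf

section

variable {K : Set ℂ}

lemma isCompact_cthickening_frontier (hK : IsCompact K) (ε : ℝ) :
    IsCompact (Metric.cthickening ε (frontier K)) :=
  Metric.isCompact_of_isClosed_isBounded Metric.isClosed_cthickening
    (hK.isBounded.subset hK.isClosed.frontier_subset).cthickening

lemma volume_cthickening_frontier_ne_top (hK : IsCompact K) (ε : ℝ) :
    volume (Metric.cthickening ε (frontier K)) ≠ ⊤ :=
  (isCompact_cthickening_frontier hK ε).measure_lt_top.ne

lemma frontierArea_mono (hK : IsCompact K) {ε δ : ℝ} (h : ε ≤ δ) :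
    frontierArea K ε ≤ frontierArea K δ :=
  measureReal_mono (Metric.cthickening_mono h _) (volume_cthickening_frontier_ne_top hK δ)

lemma frontierArea_nonneg (K : Set ℂ) (ε : ℝ) : 0 ≤ frontierArea K ε := measureReal_nonneg

lemma overlapArea_nonneg (z : ℂ) : 0 ≤ overlapArea K z := ENNReal.toReal_nonneg

lemma overlapArea_le_one (h1 : volume K = 1) (z : ℂ) : overlapArea K z ≤ 1 := by
  have := measureReal_mono (μ := volume) (inter_subset_left : K ∩ rotQuarter z K ⊆ K) (by simp [h1])
  simpa [Measure.real, h1, overlapArea] using this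

/-- `overlapArea K` changes little under small displacements. -/
lemma abs_overlapArea_sub_le (hK : IsCompact K) (z w : ℂ) :
    |overlapArea K z - overlapArea K w| ≤ frontierArea K (2 * dist z w) := by
  set E := Metric.cthickening (2 * dist z w) (frontier K) with hE
  have hEt := volume_cthickening_frontier_ne_top hK (2 * dist z w)
  have hrot : frontierArea K (2 * dist z w) = volume.real (rotQuarter z E) := by
    rw [Measure.real, volume_rotQuarter]; rfl
  have hfin : ∀ x, volume (K ∩ rotQuarter x K) ≠ ⊤ := fun x =>
    measure_ne_top_of_subset inter_subset_left hK.measure_lt_top.ne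
  -- Moving the centre by `z - w` moves the turned point by `(1 + I) * (z - w)`; the factor `2`
  -- bounds `‖1 + I‖`.
  have hdist : ∀ u, dist (z - Complex.I * (u - z)) (w - Complex.I * (u - w)) ≤ 2 * dist z w := by
    intro u
    rw [dist_eq_norm, dist_eq_norm, show z - Complex.I * (u - z) - (w - Complex.I * (u - w)) =
      (1 + Complex.I) * (z - w) by ring, norm_mul]
    gcongr
    exact (norm_add_le _ _).trans (by norm_num)
  rw [hrot]
  refine abs_measureReal_sub_le (hfin z) (hfin w) (by rwa [volume_rotQuarter]) ?_ ?_
  · rintro u ⟨h1, h2⟩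
    rw [rotQuarter_eq_preimage] at h2
    simp only [rotQuarter_eq_preimage, mem_union, mem_inter_iff, mem_preimage]
    by_cases h3 : w - Complex.I * (u - w) ∈ K
    · exact Or.inl ⟨h1, h3⟩
    · exact Or.inr (mem_cthickening_frontier_of_mem h2 h3 (hdist u))
  · rintro u ⟨h1, h2⟩
    rw [rotQuarter_eq_preimage] at h2
    simp only [rotQuarter_eq_preimage, mem_union, mem_inter_iff, mem_preimage]
    by_cases h3 : z - Complex.I * (u - z) ∈ K
    · exact Or.inl ⟨h1, h3⟩
    · exact Or.inr (mem_cthickening_frontier_of_notMem h2 h3 (by rw [dist_comm]; exact hdist u))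

/-- A finite upper limit bounds the quotient by some `c` for all small `ε`, hence the area by `2 * c
* ε`. This is the only form in which finite perimeter enters the estimates. -/
lemma exists_frontierArea_le (hp : perimeter K < ⊤) :
    ∃ M δ : ℝ, 0 < M ∧ 0 < δ ∧ ∀ ε, 0 < ε → ε ≤ δ → frontierArea K ε ≤ M * ε := by
  obtain ⟨c, hc, hc'⟩ := ENNReal.lt_iff_exists_nnreal_btwn.1 hp
  have hev := eventually_lt_of_limsup_lt hc
  rw [eventually_nhdsWithin_iff, Metric.eventually_nhds_iff] at hev
  obtain ⟨δ, hδ, h⟩ := hev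
  refine ⟨2 * c + 1, δ / 2, by positivity, by positivity, fun ε h0 h1 => ?_⟩
  have h2 := h (y := ε) (by rw [dist_zero_right, Real.norm_eq_abs, abs_of_pos h0]; linarith) h0
  rw [ENNReal.div_lt_iff (by left; simpa using h0) (by left; simp [ENNReal.mul_eq_top])] at h2
  have h3 := ENNReal.toReal_mono (by finiteness) h2.le
  rw [ENNReal.toReal_mul, ENNReal.toReal_ofReal (by positivity)] at h3
  simp only [ENNReal.coe_toReal] at h3
  calc frontierArea K ε ≤ c * (2 * ε) := h3
    _ ≤ _ := by nlinarith

lemma continuous_overlapArea (hK : IsCompact K) (hp : perimeter K < ⊤) :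
    Continuous (overlapArea K) := by
  obtain ⟨M, δ, hM, hδ, h⟩ := exists_frontierArea_le hp
  rw [Metric.continuous_iff]
  intro z ε hε
  refine ⟨min (δ / 2) (ε / (4 * M)), by positivity, fun w hw => ?_⟩
  rcases eq_or_ne w z with rfl | hne
  · simpa
  have hd : 0 < dist w z := dist_pos.2 hne
  have h1 : dist w z < δ / 2 := hw.trans_le (min_le_left _ _)
  have h2 : dist w z < ε / (4 * M) := hw.trans_le (min_le_right _ _)
  rw [lt_div_iff₀ (by positivity)] at h2
  rw [Real.dist_eq]
  have h3 := abs_overlapArea_sub_le hK w z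
  have h4 := h (2 * dist w z) (by positivity) (by linarith)
  nlinarith

lemma integrableOn_overlapArea (hK : IsCompact K) (hp : perimeter K < ⊤) :
    IntegrableOn (overlapArea K) K :=
  (continuous_overlapArea hK hp).continuousOn.integrableOn_compact hK

lemma add_mul_mem_latticeZ2 {s : ℂ} (hs : s = Complex.I ∨ s = -Complex.I) {p q : ℂ}
    (hp : p ∈ latticeZ2) (hq : q ∈ latticeZ2) : p + s * (q - p) ∈ latticeZ2 := by
  obtain ⟨a, b, rfl⟩ := hp
  obtain ⟨c, d, rfl⟩ := hq
  rcases hs with rfl | rfl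
  · exact ⟨a - (d - b), b + (c - a), by push_cast; linear_combination ((d : ℂ) - b) * Complex.I_sq⟩
  · exact ⟨a + (d - b), b - (c - a), by push_cast; linear_combination -((d : ℂ) - b) * Complex.I_sq⟩

/-! ### The triangle count in a similar copy, in terms of the ratio -/

namespace IsPlaneSimilarity

variable {φ : ℂ ≃ ℂ} {r : ℝ} {s : ℂ} {P : Finset ℂ}

lemma volume_preimage_floor_ne_top (h : IsPlaneSimilarity φ r s) (hK : IsCompact K) :
    volume ((fun z => φ.symm (latticeFloor (φ z))) ⁻¹' K) ≠ ⊤ := by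
  refine measure_ne_top_of_subset (s := K ∪ Metric.cthickening (2 / r) (frontier K)) ?_
    (measure_union_ne_top hK.measure_lt_top.ne (volume_cthickening_frontier_ne_top hK _))
  intro z hz
  by_cases hzK : z ∈ K
  · exact Or.inl hzK
  · exact Or.inr (mem_cthickening_frontier_of_notMem hz hzK (h.dist_floor_le z))

lemma abs_card_sub_le (h : IsPlaneSimilarity φ r s) (hK : IsCompact K) (h1 : volume K = 1)
    (hP : (P : Set ℂ) = φ '' K ∩ latticeZ2) :
    |(P.card : ℝ) - r ^ 2| ≤ r ^ 2 * frontierArea K (2 / r) := by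
  have hv : volume.real K = 1 := by simp [Measure.real, h1]
  rw [h.card_lattice_eq hK.measurableSet hP]
  have key : |volume.real ((fun z => φ.symm (latticeFloor (φ z))) ⁻¹' K) - volume.real K| ≤
      frontierArea K (2 / r) := by
    refine abs_measureReal_sub_le (h.volume_preimage_floor_ne_top hK) (by simp [h1])
      (volume_cthickening_frontier_ne_top hK _) ?_ ?_
    · intro z hz
      by_cases hzK : z ∈ K
      · exact Or.inl hzK
      · exact Or.inr (mem_cthickening_frontier_of_notMem hz hzK (h.dist_floor_le z))
    · intro z hz
      by_cases hzK : φ.symm (latticeFloor (φ z)) ∈ K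
      · exact Or.inl hzK
      · exact Or.inr (mem_cthickening_frontier_of_mem hz hzK (by rw [dist_comm]; exact h.dist_floor_le z))
  rw [hv] at key
  have := mul_le_mul_of_nonneg_left key (sq_nonneg r)
  rw [← abs_of_nonneg (sq_nonneg r), ← abs_mul] at this
  rw [abs_of_nonneg (sq_nonneg r), mul_sub, mul_one] at this
  exact this

/-- The number of lattice quarter turns about a lattice point of a similar copy of `K`. -/
lemma abs_card_turn_sub_le (h : IsPlaneSimilarity φ r s) (hK : IsCompact K)
    (hP : (P : Set ℂ) = φ '' K ∩ latticeZ2) {p : ℂ} (hp : p ∈ P) :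
    |((P.filter fun q => p + s * (q - p) ∈ P).card : ℝ) - r ^ 2 * overlapArea K (φ.symm p)| ≤
      r ^ 2 * (2 * frontierArea K (2 / r)) := by
  have hmem : ∀ p, p ∈ P ↔ φ.symm p ∈ K ∧ p ∈ latticeZ2 := by
    intro p
    rw [← Finset.mem_coe, hP, mem_inter_iff, Equiv.image_eq_preimage_symm]; rfl
  set z := φ.symm p with hz
  have hpz : φ z = p := by simp [hz]
  -- The turned point is automatically a lattice point, so only its membership in `φ '' K` is a
  -- condition.
  have hT : ((P.filter fun q => p + s * (q - p) ∈ P : Finset ℂ) : Set ℂ) =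
      φ '' (K ∩ rotQuarter z K) ∩ latticeZ2 := by
    ext q
    rw [rotQuarter_eq_preimage, Equiv.image_eq_preimage_symm]
    simp only [Finset.coe_filter, mem_ofPred_eq, mem_inter_iff, mem_preimage, hmem]
    have : φ.symm (p + s * (q - p)) = z - Complex.I * (φ.symm q - z) := by
      rw [Equiv.symm_apply_eq, h.turn, hpz, φ.apply_symm_apply]
    rw [this]
    constructor
    · rintro ⟨⟨a, b⟩, c, d⟩
      exact ⟨⟨a, c⟩, b⟩
    · rintro ⟨⟨a, c⟩, b⟩
      exact ⟨⟨a, b⟩, c, add_mul_mem_latticeZ2 h.dir ((hmem p).1 hp).2 b⟩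
  have hKm : MeasurableSet (K ∩ rotQuarter z K) := by
    rw [rotQuarter_eq_preimage]
    exact hK.measurableSet.inter ((by fun_prop : Measurable _) hK.measurableSet)
  rw [h.card_lattice_eq hKm hT]
  set ψ := fun z => φ.symm (latticeFloor (φ z)) with hψ
  have hψd : ∀ z, dist (ψ z) z ≤ 2 / r := h.dist_floor_le
  set E := Metric.cthickening (2 / r) (frontier K)
  have hEt : volume E ≠ ⊤ := volume_cthickening_frontier_ne_top hK _
  have hrd : ∀ u, dist (z - Complex.I * (ψ u - z)) (z - Complex.I * (u - z)) ≤ 2 / r := by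
    intro u
    refine le_trans (le_of_eq ?_) (hψd u)
    rw [dist_eq_norm, dist_comm, dist_eq_norm, show z - Complex.I * (ψ u - z) - (z - Complex.I * (u - z)) =
      Complex.I * (u - ψ u) by ring, norm_mul, Complex.norm_I, one_mul]
  -- A point can be misclassified only if it lies near the boundary of `K` or its turned image does.
  have key : |volume.real (ψ ⁻¹' (K ∩ rotQuarter z K)) - volume.real (K ∩ rotQuarter z K)| ≤
      volume.real (E ∪ rotQuarter z E) := by
    refine abs_measureReal_sub_le
      (measure_ne_top_of_subset (preimage_mono inter_subset_left) (h.volume_preimage_floor_ne_top hK))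
      (measure_ne_top_of_subset inter_subset_left hK.measure_lt_top.ne)
      (measure_union_ne_top hEt (by rwa [volume_rotQuarter])) ?_ ?_
    · rintro u ⟨h1, h2⟩
      rw [rotQuarter_eq_preimage] at h2
      simp only [rotQuarter_eq_preimage, mem_union, mem_inter_iff, mem_preimage]
      by_cases h3 : u ∈ K
      · by_cases h4 : z - Complex.I * (u - z) ∈ K
        · exact Or.inl ⟨h3, h4⟩
        · exact Or.inr (Or.inr (mem_cthickening_frontier_of_notMem h2 h4 (hrd u)))
      · exact Or.inr (Or.inl (mem_cthickening_frontier_of_notMem h1 h3 (hψd u)))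
    · rintro u ⟨h1, h2⟩
      rw [rotQuarter_eq_preimage] at h2
      simp only [rotQuarter_eq_preimage, mem_union, mem_inter_iff, mem_preimage]
      by_cases h3 : ψ u ∈ K
      · by_cases h4 : z - Complex.I * (ψ u - z) ∈ K
        · exact Or.inl ⟨h3, h4⟩
        · exact Or.inr (Or.inr (mem_cthickening_frontier_of_mem h2 h4 (by rw [dist_comm]; exact hrd u)))
      · exact Or.inr (Or.inl (mem_cthickening_frontier_of_mem h1 h3 (by rw [dist_comm]; exact hψd u)))
  have key2 : volume.real (E ∪ rotQuarter z E) ≤ 2 * frontierArea K (2 / r) := by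
    refine (measureReal_union_le _ _).trans (le_of_eq ?_)
    rw [two_mul]
    congr 1
    rw [Measure.real, volume_rotQuarter]; rfl
  rw [show overlapArea K z = volume.real (K ∩ rotQuarter z K) from rfl, ← mul_sub, abs_mul,
    abs_of_nonneg (sq_nonneg r)]
  gcongr
  exact key.trans key2

/-- The sum is the integral of the function sampled at points displaced by at most `2 / r`. The
error has two sources, each bounded by `frontierArea K (4 / r)`: points that cross the boundary, and
the variation of `overlapArea K` inside `K`. -/
lemma abs_sum_overlapArea_sub_le (h : IsPlaneSimilarity φ r s) (hK : IsCompact K)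
    (h1 : volume K = 1) (hp : perimeter K < ⊤) (hP : (P : Set ℂ) = φ '' K ∩ latticeZ2) :
    |∑ p ∈ P, overlapArea K (φ.symm p) - r ^ 2 * ∫ z in K, overlapArea K z| ≤
      r ^ 2 * (2 * frontierArea K (4 / r)) := by
  obtain ⟨hint, hsum⟩ := h.sum_lattice_eq hP (overlapArea K)
  have hr := h.pos
  have hv : volume.real K = 1 := by simp [Measure.real, h1]
  set E := Metric.cthickening (2 / r) (frontier K)
  have hEt : volume E ≠ ⊤ := volume_cthickening_frontier_ne_top hK _
  have hEm : MeasurableSet E := Metric.isClosed_cthickening.measurableSet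
  set v := frontierArea K (4 / r) with hvdef
  have hv0 : 0 ≤ v := frontierArea_nonneg _ _
  rw [hsum, ← integral_indicator hK.measurableSet, ← mul_sub, abs_mul, abs_of_nonneg (sq_nonneg r),
    ← integral_sub hint ((integrable_indicator_iff hK.measurableSet).2 (integrableOn_overlapArea hK hp))]
  gcongr
  -- If just one of `y`, `z` lies in `K`, then `z ∈ E` and the difference is at most `1`; if both
  -- do, the modulus of continuity at distance `2 / r` gives `v`.
  have hb : ∀ z, ‖K.indicator (overlapArea K) (φ.symm (latticeFloor (φ z))) -
      K.indicator (overlapArea K) z‖ ≤ E.indicator (fun _ => 1) z + K.indicator (fun _ => v) z := by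
    intro z
    have hd := h.dist_floor_le z
    generalize φ.symm (latticeFloor (φ z)) = y at hd ⊢
    have hi1 : 0 ≤ E.indicator (fun _ => (1 : ℝ)) z := indicator_nonneg (fun _ _ => zero_le_one) z
    by_cases hzK : z ∈ K <;> by_cases hyK : y ∈ K
    · rw [indicator_of_mem hzK, indicator_of_mem hyK, indicator_of_mem hzK, Real.norm_eq_abs]
      have e1 := abs_overlapArea_sub_le hK y z
      have e2 := frontierArea_mono hK (ε := 2 * dist y z) (δ := 4 / r)
        (by rw [show 4 / r = 2 * (2 / r) by ring]; gcongr)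
      linarith
    · have hE : z ∈ E := (mem_cthickening_frontier_of_mem hzK hyK (by rwa [dist_comm]))
      rw [indicator_of_mem hzK, indicator_of_notMem hyK, indicator_of_mem hzK,
        indicator_of_mem hE, Real.norm_eq_abs, zero_sub, abs_neg, abs_of_nonneg (overlapArea_nonneg z)]
      linarith [overlapArea_le_one h1 z]
    · have hE : z ∈ E := (mem_cthickening_frontier_of_notMem hyK hzK hd)
      rw [indicator_of_notMem hzK, indicator_of_mem hyK, indicator_of_notMem hzK,
        indicator_of_mem hE, Real.norm_eq_abs, sub_zero, abs_of_nonneg (overlapArea_nonneg y)]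
      linarith [overlapArea_le_one h1 y]
    · rw [indicator_of_notMem hzK, indicator_of_notMem hyK, indicator_of_notMem hzK]
      simpa using hi1
  have hi1 : Integrable (E.indicator (fun _ => (1 : ℝ))) :=
    (integrable_indicator_iff hEm).2 (integrableOn_const hEt (by simp))
  have hi2 : Integrable (K.indicator (fun _ => v)) :=
    (integrable_indicator_iff hK.measurableSet).2 (integrableOn_const (by simp [h1]) (by simp))
  refine (norm_integral_le_of_norm_le (hi1.add hi2) (ae_of_all _ hb)).trans ?_
  simp only [Pi.add_apply]
  rw [integral_add hi1 hi2, integral_indicator hEm, integral_indicator hK.measurableSet,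
    setIntegral_const, setIntegral_const, hv, smul_eq_mul, smul_eq_mul, mul_one, one_mul, two_mul]
  gcongr
  exact frontierArea_mono hK (by gcongr; norm_num)

/-- The triangle count in terms of the ratio of similarity. -/
lemma abs_num_sub_le (h : IsPlaneSimilarity φ r s) (hK : IsCompact K)
    (h1 : volume K = 1) (hp : perimeter K < ⊤) (hP : (P : Set ℂ) = φ '' K ∩ latticeZ2) :
    |(numIsoscelesRight (P : Set ℂ) : ℝ) + P.card - r ^ 4 * ∫ z in K, overlapArea K z| ≤
      P.card * (r ^ 2 * (2 * frontierArea K (4 / r))) + r ^ 4 * (2 * frontierArea K (4 / r)) := by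
  have hr := h.pos
  have hc : (numIsoscelesRight (P : Set ℂ) : ℝ) + P.card =
      ∑ p ∈ P, ((P.filter fun q => p + s * (q - p) ∈ P).card : ℝ) := by
    exact_mod_cast numIsoscelesRight_add_card h.dir P
  have e1 : |∑ p ∈ P, ((P.filter fun q => p + s * (q - p) ∈ P).card : ℝ) -
      ∑ p ∈ P, r ^ 2 * overlapArea K (φ.symm p)| ≤
      P.card * (r ^ 2 * (2 * frontierArea K (4 / r))) := by
    rw [← Finset.sum_sub_distrib, ← nsmul_eq_mul]
    refine (Finset.abs_sum_le_sum_abs _ _).trans (Finset.sum_le_card_nsmul _ _ _ fun p hp => ?_)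
    refine (h.abs_card_turn_sub_le hK hP hp).trans ?_
    gcongr
    exact frontierArea_mono hK (by gcongr; norm_num)
  have e2 := mul_le_mul_of_nonneg_left (h.abs_sum_overlapArea_sub_le hK h1 hp hP) (sq_nonneg r)
  rw [← abs_of_nonneg (sq_nonneg r), ← abs_mul, abs_of_nonneg (sq_nonneg r), mul_sub,
    Finset.mul_sum] at e2
  rw [hc]
  calc _ = |(∑ p ∈ P, ((P.filter fun q => p + s * (q - p) ∈ P).card : ℝ) -
        ∑ p ∈ P, r ^ 2 * overlapArea K (φ.symm p)) +
        (∑ p ∈ P, r ^ 2 * overlapArea K (φ.symm p) -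
          r ^ 2 * (r ^ 2 * ∫ z in K, overlapArea K z))| := by congr 1; ring
    _ ≤ _ := (abs_add_le _ _).trans (add_le_add e1 (e2.trans (le_of_eq (by ring))))

end IsPlaneSimilarity

lemma integral_overlapArea_mem_Icc (h1 : volume K = 1) :
    (∫ z in K, overlapArea K z) ∈ Icc (0 : ℝ) 1 := by
  refine ⟨integral_nonneg fun z => overlapArea_nonneg z, ?_⟩
  have := norm_setIntegral_le_of_norm_le_const (μ := volume) (s := K) (f := overlapArea K) (C := 1)
    (by simp [h1]) (fun z _ => by
      rw [Real.norm_eq_abs, abs_of_nonneg (overlapArea_nonneg z)]; exact overlapArea_le_one h1 z)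
  rw [Measure.real, h1] at this
  simpa using (le_abs_self _).trans this

/-- Unlike the perimeter bound this holds for every width, which bounds the number of lattice points
when the ratio is small. -/
lemma frontierArea_le_of_subset_closedBall (hK : IsCompact K) {R : ℝ} (hR : 0 ≤ R)
    (h : K ⊆ Metric.closedBall 0 R) {ε : ℝ} (hε : 0 ≤ ε) :
    frontierArea K ε ≤ Real.pi * (R + ε) ^ 2 := by
  have hsub : Metric.cthickening ε (frontier K) ⊆ Metric.closedBall 0 (R + ε) := by
    refine (Metric.cthickening_subset_of_subset _ (hK.isClosed.frontier_subset.trans h)).trans ?_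
    rw [cthickening_closedBall hε hR, add_comm]
  refine (measureReal_mono hsub (isCompact_closedBall _ _).measure_lt_top.ne).trans (le_of_eq ?_)
  rw [Measure.real, Complex.volume_closedBall, ENNReal.toReal_mul, ENNReal.toReal_pow,
    ENNReal.toReal_ofReal (by positivity), mul_comm]
  simp

end

/-! ### From the ratio of similarity to the number of points -/

/-- The triangle count `S` of a set with `x ^ 2` lattice points and ratio of similarity `r`. -/
lemma abs_sub_mul_sq_le {I S x r v M : ℝ} (hI0 : 0 ≤ I) (hI1 : I ≤ 1) (hx0 : 0 ≤ x)
    (hx01 : x = 0 ∨ 1 ≤ x) (hr : 0 < r) (hv0 : 0 ≤ v) (hvr : v * r ≤ 4 * M) (hv2 : v ≤ 1 / 2)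
    (hc : |x ^ 2 - r ^ 2| ≤ r ^ 2 * v)
    (hnum : |S + x ^ 2 - r ^ 4 * I| ≤ x ^ 2 * (r ^ 2 * (2 * v)) + r ^ 4 * (2 * v)) :
    |S - I * (x ^ 2) ^ 2| ≤ (1 + 288 * M) * x ^ 3 := by
  have hc' := abs_le.1 hc
  have hr2 : 0 < r ^ 2 := by positivity
  have hn2 : x ^ 2 ≤ 2 * r ^ 2 := by nlinarith
  have hrx : r ≤ 2 * x := by
    have : r ^ 2 ≤ 2 * x ^ 2 := by nlinarith
    refine abs_le_of_sq_le_sq' ?_ (by positivity) |>.2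
    nlinarith
  have e1 : |(x ^ 2) ^ 2 - r ^ 4| ≤ 3 * (r ^ 4 * v) := by
    calc |(x ^ 2) ^ 2 - r ^ 4| = |x ^ 2 - r ^ 2| * (x ^ 2 + r ^ 2) := by
          rw [show (x ^ 2) ^ 2 - r ^ 4 = (x ^ 2 - r ^ 2) * (x ^ 2 + r ^ 2) by ring, abs_mul,
            abs_of_nonneg (by positivity : 0 ≤ x ^ 2 + r ^ 2)]
      _ ≤ (r ^ 2 * v) * (3 * r ^ 2) := by gcongr; linarith
      _ = _ := by ring
  have e2 : x ^ 2 * (r ^ 2 * (2 * v)) ≤ 4 * (r ^ 4 * v) := by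
    calc _ ≤ (2 * r ^ 2) * (r ^ 2 * (2 * v)) := by gcongr
      _ = _ := by ring
  have e3 : r ^ 4 * v ≤ 32 * M * x ^ 3 := by
    calc r ^ 4 * v = r ^ 3 * (v * r) := by ring
      _ ≤ (2 * x) ^ 3 * (4 * M) := by gcongr
      _ = _ := by ring
  have e4 : |I * (r ^ 4 - (x ^ 2) ^ 2)| ≤ 3 * (r ^ 4 * v) := by
    rw [abs_mul, abs_of_nonneg hI0, abs_sub_comm]
    exact (mul_le_of_le_one_left (abs_nonneg _) hI1).trans e1
  have e5 : x ^ 2 ≤ x ^ 3 := by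
    rcases hx01 with h | h
    · simp [h]
    · exact pow_le_pow_right₀ h (by norm_num)
  have hxx := sq_nonneg x
  -- The errors add up to `(4 + 2 + 3) * (r ^ 4 * v)`, and `9 * 32 = 288`; the extra `1` pays for
  -- the degenerate pairs, `x ^ 2 ≤ x ^ 3`.
  rw [abs_le] at hnum e4 ⊢
  constructor <;> linarith

theorem triangleAsymptotics_of_perimeter_lt_top {K : Set ℂ} (hK : IsCompact K) (h1 : volume K = 1)
    (hp : perimeter K < ⊤) : TriangleAsymptotics K (∫ z in K, overlapArea K z) := by
  obtain ⟨M, δ, hM, hδ, hV⟩ := exists_frontierArea_le hp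
  obtain ⟨R', hR'⟩ := hK.isBounded.subset_closedBall 0
  obtain ⟨R, hR, hKR⟩ : ∃ R, 0 ≤ R ∧ K ⊆ Metric.closedBall 0 R :=
    ⟨max R' 0, le_max_right _ _, hR'.trans (Metric.closedBall_subset_closedBall (le_max_left _ _))⟩
  obtain ⟨hI0, hI1⟩ := integral_overlapArea_mem_Icc h1
  set I := ∫ z in K, overlapArea K z
  -- For `r ≥ r₀` the first entry makes `4 / r` an admissible width and the second gives `v ≤ 4 * M
  -- / r ≤ 1 / 2`.
  set r₀ := max (4 / δ) (8 * M) with hr₀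
  have hr₀pos : 0 < r₀ := lt_of_lt_of_le (by positivity) (le_max_left _ _)
  set B := r₀ ^ 2 + Real.pi * (R * r₀ + 2) ^ 2 with hB
  have hB0 : 0 ≤ B := by positivity
  refine ⟨B + 1 + 288 * M, fun n L hL hn => ?_⟩
  obtain ⟨φ, r, s, hφ, rfl⟩ := hL.exists_equiv
  have hr := hφ.pos
  have hfin : (φ '' K ∩ latticeZ2).Finite :=
    finite_inter_latticeZ2 (hK.image hφ.continuous).isBounded
  obtain ⟨P, hP⟩ := hfin.exists_finset_coe
  rw [← hP, Set.ncard_coe_finset] at hn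
  rw [← hP]
  have hcard := hφ.abs_card_sub_le hK h1 hP
  have hnum := hφ.abs_num_sub_le hK h1 hp hP
  have hsq := numIsoscelesRight_le_sq P
  change |_ - r ^ 4 * I| ≤ _ at hnum
  rw [hn] at hcard hnum hsq
  have hsq' : (numIsoscelesRight (P : Set ℂ) : ℝ) ≤ (n : ℝ) ^ 2 := by exact_mod_cast hsq
  set S : ℝ := (numIsoscelesRight (P : Set ℂ) : ℝ) with hS
  have hS0 : 0 ≤ S := Nat.cast_nonneg _
  set x := √(n : ℝ) with hx
  have hx0 : 0 ≤ x := Real.sqrt_nonneg _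
  have hx2 : x ^ 2 = n := Real.sq_sqrt (Nat.cast_nonneg n)
  have hx3 : (n : ℝ) ^ (3 / 2 : ℝ) = x ^ 3 := by
    rw [hx, Real.sqrt_eq_rpow, ← Real.rpow_natCast, ← Real.rpow_mul (Nat.cast_nonneg n)]
    norm_num
  have hx01 : x = 0 ∨ 1 ≤ x := by
    rcases Nat.eq_zero_or_pos n with h | h
    · left; simp [hx, h]
    · right; rw [hx, Real.one_le_sqrt]; exact_mod_cast h
  rw [hx3, ← hx2]
  rw [← hx2] at hcard hnum hsq'
  have hxle : x ≤ x ^ 2 := by rcases hx01 with h | h <;> nlinarith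
  have hx3pos : 0 ≤ x ^ 3 := by positivity
  rcases lt_or_ge r r₀ with hlt | hge
  · have hxB : x ^ 2 ≤ B := by
      have e1 := (abs_le.1 hcard).2
      have e2 := frontierArea_le_of_subset_closedBall hK hR hKR (ε := 2 / r) (by positivity)
      calc x ^ 2 ≤ r ^ 2 + r ^ 2 * frontierArea K (2 / r) := by linarith
        _ ≤ r ^ 2 + r ^ 2 * (Real.pi * (R + 2 / r) ^ 2) := by gcongr
        _ = r ^ 2 + Real.pi * (R * r + 2) ^ 2 := by field_simp
        _ ≤ B := by rw [hB]; gcongr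
    have hIn : I * (x ^ 2) ^ 2 ≤ (x ^ 2) ^ 2 := mul_le_of_le_one_left (by positivity) hI1
    have hIn0 : 0 ≤ I * (x ^ 2) ^ 2 := by positivity
    -- Both terms lie in `[0, n ^ 2]`, and `n ^ 2 = x * x ^ 3` with `x ≤ x ^ 2 ≤ B`.
    calc |S - I * (x ^ 2) ^ 2| ≤ (x ^ 2) ^ 2 := by rw [abs_le]; constructor <;> linarith
      _ = x * x ^ 3 := by ring
      _ ≤ (B + 1 + 288 * M) * x ^ 3 := by gcongr; linarith
  · set v := frontierArea K (4 / r) with hv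
    have hv0 : 0 ≤ v := frontierArea_nonneg _ _
    have hvr : v * r ≤ 4 * M := by
      have := hV (4 / r) (by positivity) (by
        rw [div_le_comm₀ hr hδ]; exact (le_max_left _ _).trans hge)
      rw [← hv, mul_div_assoc', le_div_iff₀ hr] at this
      linarith
    have hrM : 8 * M ≤ r := (le_max_right _ _).trans hge
    have hv2 : v ≤ 1 / 2 := by
      by_contra! hcon
      nlinarith
    have hvv : frontierArea K (2 / r) ≤ v := frontierArea_mono hK (by gcongr; norm_num)
    have hc : |x ^ 2 - r ^ 2| ≤ r ^ 2 * v := hcard.trans (by gcongr)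
    refine (abs_sub_mul_sq_le hI0 hI1 hx0 hx01 hr hv0 hvr hv2 hc hnum).trans ?_
    gcongr
    linarith

/-! ### A criterion for finite perimeter -/

/-- A sublevel set of a `1`-Lipschitz function whose sublevel sets have quadratic area has finite
perimeter. -/
lemma perimeter_sublevel_lt_top {p : ℂ → ℝ} (hp : ∀ z w, |p z - p w| ≤ dist z w) {A r : ℝ}
    (hA : 0 ≤ A) (hr : 0 < r)
    (hvol : ∀ s, 0 ≤ s → volume {z | p z ≤ s} = ENNReal.ofReal (A * s ^ 2)) :
    perimeter {z | p z ≤ r} < ⊤ := by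
  have hcont : Continuous p := by
    refine LipschitzWith.continuous (K := 1) (LipschitzWith.of_dist_le_mul fun z w => ?_)
    simpa [Real.dist_eq] using hp z w
  have hmeas : ∀ s, MeasurableSet {z | p z ≤ s} := fun s =>
    measurableSet_le hcont.measurable measurable_const
  have hfr : ∀ z ∈ frontier {z | p z ≤ r}, p z = r :=
    fun z hz => frontier_le_subset_eq hcont continuous_const hz
  -- The neighbourhood lies in the shell between levels `r - 2 * δ` and `r + 2 * δ`, of area `8 * A
  -- * r * δ`; dividing by `2 * δ` leaves `4 * A * r`.
  refine lt_of_le_of_lt (b := ENNReal.ofReal (4 * A * r)) ?_ ENNReal.ofReal_lt_top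
  refine limsup_le_of_le (by isBoundedDefault) ?_
  filter_upwards [Ioo_mem_nhdsGT (show (0 : ℝ) < r / 2 by positivity)] with δ hδ
  have hδ0 := hδ.1
  have hδr := hδ.2
  refine ENNReal.div_le_of_le_mul ?_
  have hsub : Metric.cthickening δ (frontier {z | p z ≤ r}) ⊆
      {z | p z ≤ r + 2 * δ} \ {z | p z ≤ r - 2 * δ} := by
    intro z hz
    -- Doubling the width gives an open thickening, hence an actual frontier point `y` within `2 *
    -- δ`.
    obtain ⟨y, hy, hyz⟩ := Metric.mem_thickening_iff.1
      (Metric.cthickening_subset_thickening' (δ₂ := 2 * δ) (by positivity) (by linarith) _ hz)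
    have h1 := abs_le.1 (hp z y)
    have h2 := hfr y hy
    refine ⟨?_, ?_⟩
    · change p z ≤ r + 2 * δ
      linarith
    · change ¬ p z ≤ r - 2 * δ
      linarith
  refine (measure_mono hsub).trans ?_
  rw [measure_sdiff (show {z | p z ≤ r - 2 * δ} ⊆ {z | p z ≤ r + 2 * δ} by
    intro z hz
    rw [mem_ofPred_eq] at hz ⊢
    linarith) (hmeas _).nullMeasurableSet
    (by rw [hvol _ (by linarith)]; exact ENNReal.ofReal_ne_top), hvol _ (by linarith),
    hvol _ (by linarith), ← ENNReal.ofReal_sub _ (by positivity),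
    ← ENNReal.ofReal_mul (by positivity)]
  apply ENNReal.ofReal_le_ofReal
  apply le_of_eq
  ring

/-! ### The square -/

lemma unitAreaSquare_eq_reProdIm :
    unitAreaSquare = Icc (-(1 / 2) : ℝ) (1 / 2) ×ℂ Icc (-(1 / 2) : ℝ) (1 / 2) := by
  ext z
  simp [unitAreaSquare, Complex.mem_reProdIm, abs_le]

lemma isCompact_unitAreaSquare : IsCompact unitAreaSquare := by
  rw [unitAreaSquare_eq_reProdIm]
  exact isCompact_Icc.reProdIm isCompact_Icc

lemma volume_unitAreaSquare : volume unitAreaSquare = 1 := by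
  rw [unitAreaSquare_eq_reProdIm, volume_reProdIm, Real.volume_Icc]
  norm_num

lemma perimeter_unitAreaSquare_lt_top : perimeter unitAreaSquare < ⊤ := by
  have : unitAreaSquare = {z : ℂ | max |z.re| |z.im| ≤ 1 / 2} := by
    ext z; simp [unitAreaSquare]
  rw [this]
  refine perimeter_sublevel_lt_top (A := 4) (fun z w => ?_) (by norm_num) (by norm_num)
    fun s hs => ?_
  · refine (abs_max_sub_max_le_max _ _ _ _).trans (max_le ?_ ?_)
    · refine (abs_abs_sub_abs_le_abs_sub _ _).trans ?_
      rw [← Complex.sub_re, dist_eq_norm]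
      exact Complex.abs_re_le_norm _
    · refine (abs_abs_sub_abs_le_abs_sub _ _).trans ?_
      rw [← Complex.sub_im, dist_eq_norm]
      exact Complex.abs_im_le_norm _
  · have : {z : ℂ | max |z.re| |z.im| ≤ s} = Icc (-s) s ×ℂ Icc (-s) s := by
      ext z
      simp [Complex.mem_reProdIm, abs_le]
    rw [this, volume_reProdIm, Real.volume_Icc, ← ENNReal.ofReal_mul (by linarith)]
    ring_nf

lemma volume_Icc_inter_translate (c : ℝ) :
    volume (Icc (-(1 / 2) : ℝ) (1 / 2) ∩ Icc (c - 1 / 2) (c + 1 / 2)) =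
      ENNReal.ofReal (1 - |c|) := by
  rw [Icc_inter_Icc, Real.volume_Icc]
  congr 1
  rcases le_total 0 c with h | h
  · rw [abs_of_nonneg h, min_eq_left (by linarith), max_eq_right (by linarith)]; ring
  · rw [abs_of_nonpos h, min_eq_right (by linarith), max_eq_left (by linarith)]; ring

/-- A quarter turn maps the square to a translate of itself with centre `z - I * z`, so the overlap
is a rectangle whose sides are overlaps of translated unit intervals. -/
lemma overlapArea_unitAreaSquare {z : ℂ} (hz : z ∈ unitAreaSquare) :
    overlapArea unitAreaSquare z = (1 - |z.re + z.im|) * (1 - |z.re - z.im|) := by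
  have h : unitAreaSquare ∩ rotQuarter z unitAreaSquare =
      (Icc (-(1 / 2) : ℝ) (1 / 2) ∩ Icc (z.re + z.im - 1 / 2) (z.re + z.im + 1 / 2)) ×ℂ
      (Icc (-(1 / 2) : ℝ) (1 / 2) ∩ Icc (z.im - z.re - 1 / 2) (z.im - z.re + 1 / 2)) := by
    ext w
    rw [rotQuarter_eq_preimage]
    simp only [unitAreaSquare, mem_inter_iff, mem_preimage, mem_ofPred_eq, Complex.mem_reProdIm,
      mem_Icc, abs_le, Complex.sub_re, Complex.sub_im, Complex.mul_re, Complex.mul_im,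
      Complex.I_re, Complex.I_im]
    constructor
    · rintro ⟨⟨⟨h1, h2⟩, h3, h4⟩, ⟨h5, h6⟩, h7, h8⟩
      refine ⟨⟨⟨?_, ?_⟩, ?_, ?_⟩, ⟨?_, ?_⟩, ?_, ?_⟩ <;> linarith
    · rintro ⟨⟨⟨h1, h2⟩, h3, h4⟩, ⟨h5, h6⟩, h7, h8⟩
      refine ⟨⟨⟨?_, ?_⟩, ?_, ?_⟩, ⟨?_, ?_⟩, ?_, ?_⟩ <;> linarith
  have h1 := abs_le.1 hz.1
  have h2 := abs_le.1 hz.2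
  have h3 : 0 ≤ 1 - |z.re + z.im| := by
    have : |z.re + z.im| ≤ 1 := by rw [abs_le]; constructor <;> linarith
    linarith
  have h4 : 0 ≤ 1 - |z.re - z.im| := by
    have : |z.re - z.im| ≤ 1 := by rw [abs_le]; constructor <;> linarith
    linarith
  rw [overlapArea, h, volume_reProdIm, volume_Icc_inter_translate, volume_Icc_inter_translate,
    abs_sub_comm z.im, ENNReal.toReal_mul, ENNReal.toReal_ofReal h3, ENNReal.toReal_ofReal h4]

lemma integral_cubic (c₀ c₁ c₂ c₃ a b : ℝ) :
    ∫ y in a..b, (c₀ + c₁ * y + c₂ * y ^ 2 + c₃ * y ^ 3) =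
      c₀ * (b - a) + c₁ * (b ^ 2 - a ^ 2) / 2 + c₂ * (b ^ 3 - a ^ 3) / 3 +
        c₃ * (b ^ 4 - a ^ 4) / 4 := by
  rw [intervalIntegral.integral_eq_sub_of_hasDerivAt
    (f := fun y => c₀ * y + c₁ * y ^ 2 / 2 + c₂ * y ^ 3 / 3 + c₃ * y ^ 4 / 4)]
  · ring
  · intro y _
    have h := ((((hasDerivAt_id y).const_mul c₀).add
      (((hasDerivAt_pow 2 y).const_mul c₁).div_const 2)).add
      (((hasDerivAt_pow 3 y).const_mul c₂).div_const 3)).add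
      (((hasDerivAt_pow 4 y).const_mul c₃).div_const 4)
    refine HasDerivAt.congr_deriv h ?_
    norm_num
    ring
  · exact Continuous.intervalIntegrable (by fun_prop) _ _

lemma integral_square_slice {a : ℝ} (h0 : 0 ≤ a) (h1 : a ≤ 1 / 2) :
    ∫ y in (-(1 / 2) : ℝ)..(1 / 2), (1 - |a + y|) * (1 - |a - y|) =
      7 / 12 - 3 * a ^ 2 + 8 / 3 * a ^ 3 := by
  have hi : ∀ u v : ℝ, IntervalIntegrable (fun y => (1 - |a + y|) * (1 - |a - y|)) volume u v :=
    fun u v => Continuous.intervalIntegrable (by fun_prop) _ _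
  have e1 : ∫ y in (-(1 / 2) : ℝ)..(-a), (1 - |a + y|) * (1 - |a - y|) =
      ∫ y in (-(1 / 2) : ℝ)..(-a), ((1 - a ^ 2) + 2 * y + 1 * y ^ 2 + 0 * y ^ 3) := by
    refine intervalIntegral.integral_congr fun y hy => ?_
    rw [uIcc_of_le (by linarith)] at hy
    rw [abs_of_nonpos (by linarith [hy.2]), abs_of_nonneg (by linarith [hy.2])]
    ring
  have e2 : ∫ y in (-a)..a, (1 - |a + y|) * (1 - |a - y|) =
      ∫ y in (-a)..a, ((1 - a) ^ 2 + 0 * y + (-1) * y ^ 2 + 0 * y ^ 3) := by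
    refine intervalIntegral.integral_congr fun y hy => ?_
    rw [uIcc_of_le (by linarith)] at hy
    rw [abs_of_nonneg (by linarith [hy.1]), abs_of_nonneg (by linarith [hy.2])]
    ring
  have e3 : ∫ y in a..(1 / 2), (1 - |a + y|) * (1 - |a - y|) =
      ∫ y in a..(1 / 2), ((1 - a ^ 2) + (-2) * y + 1 * y ^ 2 + 0 * y ^ 3) := by
    refine intervalIntegral.integral_congr fun y hy => ?_
    rw [uIcc_of_le (by linarith)] at hy
    rw [abs_of_nonneg (by linarith [hy.1]), abs_of_nonpos (by linarith [hy.1])]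
    ring
  rw [← intervalIntegral.integral_add_adjacent_intervals (hi _ (-a)) (hi (-a) _),
    ← intervalIntegral.integral_add_adjacent_intervals (hi (-a) a) (hi a _), e1, e2, e3,
    integral_cubic, integral_cubic, integral_cubic]
  ring

lemma setIntegral_reProdIm {s t : Set ℝ} (f : ℝ × ℝ → ℝ)
    (hf : IntegrableOn f (s ×ˢ t)) :
    ∫ z in s ×ℂ t, f (z.re, z.im) = ∫ x in s, ∫ y in t, f (x, y) := by
  rw [Measure.volume_eq_prod] at hf
  rw [← setIntegral_prod _ hf, ← Measure.volume_eq_prod,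
    ← Complex.volume_preserving_equiv_real_prod.setIntegral_preimage_emb
      Complex.measurableEquivRealProd.measurableEmbedding]
  rfl

lemma integral_overlapArea_unitAreaSquare :
    ∫ z in unitAreaSquare, overlapArea unitAreaSquare z = 5 / 12 := by
  have hm : MeasurableSet unitAreaSquare := isCompact_unitAreaSquare.measurableSet
  rw [setIntegral_congr_fun hm fun z hz => overlapArea_unitAreaSquare hz,
    unitAreaSquare_eq_reProdIm]
  rw [setIntegral_reProdIm (fun q : ℝ × ℝ => (1 - |q.1 + q.2|) * (1 - |q.1 - q.2|))
    (Continuous.continuousOn (by fun_prop) |>.integrableOn_compact (isCompact_Icc.prod isCompact_Icc))]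
  have hs : ∀ x ∈ Icc (-(1 / 2) : ℝ) (1 / 2),
      ∫ y in Icc (-(1 / 2) : ℝ) (1 / 2), (1 - |x + y|) * (1 - |x - y|) =
        7 / 12 - 3 * |x| ^ 2 + 8 / 3 * |x| ^ 3 := by
    intro x hx
    rw [integral_Icc_eq_integral_Ioc, ← intervalIntegral.integral_of_le (by norm_num),
      ← integral_square_slice (abs_nonneg x) (abs_le.2 hx)]
    -- Replacing `x` by `-x` exchanges the two factors.
    rcases abs_cases x with ⟨h, _⟩ | ⟨h, _⟩
    · rw [h]
    · refine intervalIntegral.integral_congr fun y _ => ?_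
      rw [h, show -x + y = -(x - y) by ring, show -x - y = -(x + y) by ring, abs_neg, abs_neg,
        mul_comm]
  rw [setIntegral_congr_fun measurableSet_Icc hs, integral_Icc_eq_integral_Ioc,
    ← intervalIntegral.integral_of_le (by norm_num)]
  have hi : ∀ u v : ℝ, IntervalIntegrable
      (fun x : ℝ => 7 / 12 - 3 * |x| ^ 2 + 8 / 3 * |x| ^ 3) volume u v :=
    fun u v => Continuous.intervalIntegrable (by fun_prop) _ _
  have e1 : ∫ x in (-(1 / 2) : ℝ)..0, (7 / 12 - 3 * |x| ^ 2 + 8 / 3 * |x| ^ 3) =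
      ∫ x in (-(1 / 2) : ℝ)..0, (7 / 12 + 0 * x + (-3) * x ^ 2 + (-8 / 3) * x ^ 3) := by
    refine intervalIntegral.integral_congr fun x hx => ?_
    rw [uIcc_of_le (by norm_num)] at hx
    rw [abs_of_nonpos hx.2]
    ring
  have e2 : ∫ x in (0 : ℝ)..(1 / 2), (7 / 12 - 3 * |x| ^ 2 + 8 / 3 * |x| ^ 3) =
      ∫ x in (0 : ℝ)..(1 / 2), (7 / 12 + 0 * x + (-3) * x ^ 2 + (8 / 3) * x ^ 3) := by
    refine intervalIntegral.integral_congr fun x hx => ?_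
    rw [uIcc_of_le (by norm_num)] at hx
    rw [abs_of_nonneg hx.1]
    ring
  rw [← intervalIntegral.integral_add_adjacent_intervals (hi _ 0) (hi _ _), e1, e2,
    integral_cubic, integral_cubic]
  norm_num

/-! ### The disk -/

lemma volume_sq_le (m : ℝ) : volume {y : ℝ | y ^ 2 ≤ m} = ENNReal.ofReal (2 * √m) := by
  rcases lt_or_ge m 0 with h | h
  · have : {y : ℝ | y ^ 2 ≤ m} = ∅ := by
      ext y
      simp only [mem_ofPred_eq, mem_empty_iff_false, iff_false, not_le]
      exact h.trans_le (sq_nonneg y)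
    rw [this, Real.sqrt_eq_zero_of_nonpos h.le]
    simp
  · have : {y : ℝ | y ^ 2 ≤ m} = Icc (-√m) (√m) := by
      ext y
      rw [mem_ofPred_eq, Real.sq_le h, mem_Icc]
    rw [this, Real.volume_Icc]
    congr 1
    ring

/-- The area of the intersection of two disks of radius `ρ` whose centres have distance `2 t`. -/
lemma volumeReal_lens {ρ t : ℝ} (ht : 0 ≤ t) (htρ : t ≤ ρ) :
    volume.real {w : ℂ | ‖w‖ ≤ ρ ∧ ‖w - ((2 * t : ℝ) : ℂ)‖ ≤ ρ} =
      4 * ∫ x in t..ρ, √(ρ ^ 2 - x ^ 2) := by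
  have hρ : 0 ≤ ρ := ht.trans htρ
  set S : Set (ℝ × ℝ) := {q | q.2 ^ 2 ≤ ρ ^ 2 - max (q.1 ^ 2) ((2 * t - q.1) ^ 2)} with hS
  have hSm : MeasurableSet S := measurableSet_le (by fun_prop) (by fun_prop)
  have hpre : {w : ℂ | ‖w‖ ≤ ρ ∧ ‖w - ((2 * t : ℝ) : ℂ)‖ ≤ ρ} =
      Complex.measurableEquivRealProd ⁻¹' S := by
    ext w
    have h : ∀ u : ℂ, ‖u‖ ≤ ρ ↔ u.re ^ 2 + u.im ^ 2 ≤ ρ ^ 2 := by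
      intro u
      rw [← sq_le_sq₀ (norm_nonneg u) hρ, ← Complex.normSq_eq_norm_sq, Complex.normSq_apply]
      ring_nf
    simp only [mem_ofPred_eq, h, hS, mem_preimage, Complex.measurableEquivRealProd_apply,
      Complex.sub_re, Complex.sub_im, Complex.ofReal_re, Complex.ofReal_im, sub_zero]
    rw [le_sub_comm, max_le_iff]
    constructor
    · rintro ⟨h1, h2⟩
      constructor <;> linarith
    · rintro ⟨h1, h2⟩
      constructor <;> linarith
  -- `√` of a negative number is `0`, so `k` is the length of the vertical slice at every `x`,
  -- including those that miss the lens.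
  set k : ℝ → ℝ := fun x => 2 * √(ρ ^ 2 - max (x ^ 2) ((2 * t - x) ^ 2)) with hk
  have hkc : Continuous k := by fun_prop
  have h1 : volume.real {w : ℂ | ‖w‖ ≤ ρ ∧ ‖w - ((2 * t : ℝ) : ℂ)‖ ≤ ρ} = ∫ x, k x := by
    rw [Measure.real, hpre, Complex.volume_preserving_equiv_real_prod.measure_preimage_equiv,
      Measure.volume_eq_prod, Measure.prod_apply hSm,
      integral_eq_lintegral_of_nonneg_ae (ae_of_all _ fun x => by positivity)
        hkc.aestronglyMeasurable]
    congr 1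
    refine lintegral_congr fun x => ?_
    rw [← volume_sq_le]
    rfl
  have hsupp : Function.support k ⊆ Ioc (2 * t - ρ) ρ := by
    intro x hx
    rw [Function.mem_support] at hx
    have hpos : 0 < ρ ^ 2 - max (x ^ 2) ((2 * t - x) ^ 2) := by
      by_contra! hcon
      exact hx (by rw [hk]; simp only; rw [Real.sqrt_eq_zero_of_nonpos hcon, mul_zero])
    rw [sub_pos, max_lt_iff] at hpos
    have e1 := abs_lt.1 (abs_lt_of_sq_lt_sq hpos.1 hρ)
    have e2 := abs_lt.1 (abs_lt_of_sq_lt_sq hpos.2 hρ)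
    exact ⟨by linarith [e2.2], e1.2.le⟩
  have hright : ∫ x in t..ρ, k x = 2 * ∫ x in t..ρ, √(ρ ^ 2 - x ^ 2) := by
    rw [← intervalIntegral.integral_const_mul]
    refine intervalIntegral.integral_congr fun x hx => ?_
    rw [uIcc_of_le htρ] at hx
    simp only [hk]
    rw [max_eq_left (by nlinarith [hx.1])]
  -- The lens is symmetric under the reflection `x ↦ 2 * t - x` that exchanges the two centres.
  have hleft : ∫ x in (2 * t - ρ)..t, k x = ∫ x in t..ρ, k x := by
    have := intervalIntegral.integral_comp_sub_left (a := t) (b := ρ) k (2 * t)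
    rw [show 2 * t - t = t by ring] at this
    rw [← this]
    refine intervalIntegral.integral_congr fun x _ => ?_
    simp only [hk]
    rw [max_comm, sub_sub_cancel]
  rw [h1, ← intervalIntegral.integral_eq_integral_of_support_subset hsupp,
    ← intervalIntegral.integral_add_adjacent_intervals (hkc.intervalIntegrable _ t)
      (hkc.intervalIntegrable _ _), hleft, hright]
  ring

lemma integral_sqrt_one_sub_sq_Icc {u : ℝ} (h0 : 0 ≤ u) (h1 : u ≤ 1) :
    ∫ x in u..1, √(1 - x ^ 2) = (Real.pi / 2 - u * √(1 - u ^ 2) - Real.arcsin u) / 2 := by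
  rw [intervalIntegral.integral_eq_sub_of_hasDerivAt_of_le
    (f := fun x => (x * √(1 - x ^ 2) + Real.arcsin x) / 2) h1]
  · simp
    ring
  · exact Continuous.continuousOn (by have := Real.continuous_arcsin; fun_prop)
  · intro x hx
    have hx1 : 0 < 1 - x ^ 2 := by nlinarith [hx.1, hx.2]
    have hd : HasDerivAt (fun x : ℝ => 1 - x ^ 2) (-(2 * x)) x := by
      simpa using (hasDerivAt_pow 2 x).const_sub 1
    have h := (((hasDerivAt_id x).mul (hd.sqrt hx1.ne')).add
      (Real.hasDerivAt_arcsin (by linarith [hx.1]) hx.2.ne)).div_const 2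
    refine HasDerivAt.congr_deriv h ?_
    have hs := Real.sqrt_pos.2 hx1
    have hsq := Real.sq_sqrt hx1.le
    simp only [id]
    field_simp
    rw [hsq]
    ring
  · exact Continuous.intervalIntegrable (by fun_prop) _ _

lemma integral_sqrt_sq_sub_sq {ρ t : ℝ} (hρ : 0 < ρ) (ht : 0 ≤ t) (htρ : t ≤ ρ) :
    ∫ x in t..ρ, √(ρ ^ 2 - x ^ 2) =
      ρ ^ 2 * ((Real.pi / 2 - t / ρ * √(1 - (t / ρ) ^ 2) - Real.arcsin (t / ρ)) / 2) := by
  have h : ∀ x : ℝ, √(ρ ^ 2 - x ^ 2) = ρ * √(1 - (x / ρ) ^ 2) := by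
    intro x
    rw [show ρ ^ 2 - x ^ 2 = ρ ^ 2 * (1 - (x / ρ) ^ 2) by field_simp,
      Real.sqrt_mul (sq_nonneg ρ), Real.sqrt_sq hρ.le]
  simp_rw [h]
  rw [intervalIntegral.integral_const_mul,
    intervalIntegral.integral_comp_div (fun x => √(1 - x ^ 2)) hρ.ne', div_self hρ.ne',
    integral_sqrt_one_sub_sq_Icc (by positivity) ((div_le_one hρ).2 htρ), smul_eq_mul]
  ring

lemma integral_mul_lens :
    ∫ u in (0 : ℝ)..(√2 / 2), u * (Real.pi / 2 - u * √(1 - u ^ 2) - Real.arcsin u) =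
      3 * Real.pi / 32 - 1 / 8 := by
  have h2 : (√2 / 2) ^ 2 = (1 / 2 : ℝ) := by
    rw [div_pow, Real.sq_sqrt (by norm_num)]; norm_num
  have hlt : √2 / 2 < (1 : ℝ) := by
    by_contra! h
    nlinarith
  -- The antiderivative comes from integrating `u * arcsin u` by parts and from the standard one of
  -- `u ^ 2 * √(1 - u ^ 2)`.
  rw [intervalIntegral.integral_eq_sub_of_hasDerivAt
    (f := fun u => Real.pi * u ^ 2 / 4 - u ^ 2 / 2 * Real.arcsin u +
      (Real.arcsin u - u * √(1 - u ^ 2)) / 4 - u * (2 * u ^ 2 - 1) * √(1 - u ^ 2) / 8 -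
      Real.arcsin u / 8)]
  · have ha : Real.arcsin (√2 / 2) = Real.pi / 4 := by
      rw [← Real.sin_pi_div_four, Real.arcsin_sin] <;> linarith [Real.pi_pos]
    have hs : √(1 - (√2 / 2) ^ 2) = √2 / 2 := by
      rw [h2, show (1 - 1 / 2 : ℝ) = (√2 / 2) ^ 2 by rw [h2]; norm_num,
        Real.sqrt_sq (by positivity)]
    simp only [hs, ha, Real.arcsin_zero]
    have h2' : (√2 / 2) * (√2 / 2) = (1 / 2 : ℝ) := by rw [← sq, h2]
    rw [h2, h2']
    ring
  · intro x hx
    rw [uIcc_of_le (by positivity)] at hx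
    have hxl : x < 1 := hx.2.trans_lt hlt
    have hx1 : 0 < 1 - x ^ 2 := by nlinarith [hx.1]
    have hd : HasDerivAt (fun x : ℝ => 1 - x ^ 2) (-(2 * x)) x := by
      simpa using (hasDerivAt_pow 2 x).const_sub 1
    have hsd := hd.sqrt hx1.ne'
    have had := Real.hasDerivAt_arcsin (x := x) (by linarith [hx.1]) hxl.ne
    have hp := hasDerivAt_pow 2 x
    have h := (((((hp.const_mul Real.pi).div_const 4).sub ((hp.div_const 2).mul had)).add
      ((had.sub ((hasDerivAt_id x).mul hsd)).div_const 4)).sub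
      ((((hasDerivAt_id x).mul ((hp.const_mul 2).sub_const 1)).mul hsd).div_const 8)).sub
      (had.div_const 8)
    refine HasDerivAt.congr_deriv h ?_
    have hs := Real.sqrt_pos.2 hx1
    have hsq := Real.sq_sqrt hx1.le
    simp only [Pi.mul_apply, id]
    norm_num
    generalize √(1 - x ^ 2) = y at hs hsq
    field_simp
    linear_combination (16 * x ^ 2 - 8) * hsq
  · exact Continuous.intervalIntegrable (by have := Real.continuous_arcsin; fun_prop) _ _

lemma sq_one_div_sqrt_pi : (1 / √Real.pi) ^ 2 = 1 / Real.pi := by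
  rw [div_pow, Real.sq_sqrt Real.pi_pos.le, one_pow]

lemma unitAreaDisk_eq_closedBall : unitAreaDisk = Metric.closedBall 0 (1 / √Real.pi) := by
  ext z
  simp [unitAreaDisk]

lemma isCompact_unitAreaDisk : IsCompact unitAreaDisk := by
  rw [unitAreaDisk_eq_closedBall]
  exact isCompact_closedBall _ _

lemma volume_norm_le {s : ℝ} (hs : 0 ≤ s) :
    volume {z : ℂ | ‖z‖ ≤ s} = ENNReal.ofReal (Real.pi * s ^ 2) := by
  have : {z : ℂ | ‖z‖ ≤ s} = Metric.closedBall 0 s := by ext z; simp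
  rw [this, Complex.volume_closedBall, ← ENNReal.ofReal_pow hs, mul_comm,
    ENNReal.ofReal_mul Real.pi_pos.le, ← NNReal.coe_real_pi, ENNReal.ofReal_coe_nnreal]

lemma volume_unitAreaDisk : volume unitAreaDisk = 1 := by
  rw [unitAreaDisk, volume_norm_le (by positivity), sq_one_div_sqrt_pi,
    mul_one_div_cancel Real.pi_pos.ne', ENNReal.ofReal_one]

lemma perimeter_unitAreaDisk_lt_top : perimeter unitAreaDisk < ⊤ := by
  refine perimeter_sublevel_lt_top (A := Real.pi) (fun z w => ?_) Real.pi_pos.le (by positivity)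
    fun s hs => volume_norm_le hs
  rw [dist_eq_norm]
  exact abs_norm_sub_norm_le z w

/-- The turned disk has centre `(1 - I) * z`, at distance `√2 * ‖z‖ = 2 * t` from `0`. A rotation by
a unit `u` puts this centre on the real axis and reduces the overlap to the standard lens. -/
lemma overlapArea_disk {ρ : ℝ} (hρ : 0 < ρ) {z : ℂ} (hz : ‖z‖ ≤ ρ) :
    overlapArea {w : ℂ | ‖w‖ ≤ ρ} z = 2 * ρ ^ 2 * (Real.pi / 2 -
      ‖z‖ / (√2 * ρ) * √(1 - (‖z‖ / (√2 * ρ)) ^ 2) - Real.arcsin (‖z‖ / (√2 * ρ))) := by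
  set t : ℝ := ‖z‖ / √2 with ht
  have h2 : √2 * √2 = (2 : ℝ) := Real.mul_self_sqrt (by norm_num)
  have hs2 : (0 : ℝ) < √2 := by positivity
  have ht0 : 0 ≤ t := by positivity
  have htρ : t ≤ ρ := by
    rw [ht, div_le_iff₀ hs2]
    have : (1 : ℝ) ≤ √2 := by rw [Real.one_le_sqrt]; norm_num
    nlinarith
  obtain ⟨u, hu, hc⟩ : ∃ u : ℂ, ‖u‖ = 1 ∧ (1 - Complex.I) * z = u * ((2 * t : ℝ) : ℂ) := by
    refine ⟨Complex.exp (Complex.arg ((1 - Complex.I) * z) * Complex.I),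
      Complex.norm_exp_ofReal_mul_I _, ?_⟩
    have hn : ‖(1 - Complex.I) * z‖ = 2 * t := by
      have : ‖(1 - Complex.I)‖ = √2 := by
        rw [Complex.norm_def, Complex.normSq_apply]; norm_num
      rw [norm_mul, this, ht, mul_div_assoc', eq_div_iff hs2.ne']
      linear_combination ‖z‖ * h2
    rw [← hn, mul_comm (Complex.exp _), Complex.norm_mul_exp_arg_mul_I]
  have hu0 : u ≠ 0 := by rintro rfl; simp at hu
  have hpre : (fun w => u * w) ⁻¹' ({w : ℂ | ‖w‖ ≤ ρ} ∩ rotQuarter z {w : ℂ | ‖w‖ ≤ ρ}) =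
      {w : ℂ | ‖w‖ ≤ ρ ∧ ‖w - ((2 * t : ℝ) : ℂ)‖ ≤ ρ} := by
    ext w
    rw [rotQuarter_eq_preimage]
    simp only [mem_preimage, mem_inter_iff, mem_ofPred_eq]
    have : z - Complex.I * (u * w - z) = -Complex.I * (u * (w - ((2 * t : ℝ) : ℂ))) := by
      rw [mul_sub u, ← hc]
      linear_combination z * Complex.I_sq
    rw [this, norm_mul, norm_mul, norm_mul, hu]
    simp
  have hvol := volume_preimage_mul hu0 ({w : ℂ | ‖w‖ ≤ ρ} ∩ rotQuarter z {w : ℂ | ‖w‖ ≤ ρ})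
  rw [hpre, hu] at hvol
  simp only [one_pow, inv_one, ENNReal.ofReal_one, one_mul] at hvol
  rw [overlapArea, ← hvol]
  have := volumeReal_lens ht0 htρ
  rw [Measure.real] at this
  rw [this, integral_sqrt_sq_sub_sq hρ ht0 htρ, ht, div_div]
  ring

/-- The overlap depends only on `‖z‖`, so polar coordinates apply; the substitution `u = y / (√2 *
ρ)` turns the radial integral over `[0, ρ]` into `integral_mul_lens` over `[0, √2 / 2]`. -/
lemma integral_overlapArea_disk {ρ : ℝ} (hρ : 0 < ρ) :
    ∫ z in {w : ℂ | ‖w‖ ≤ ρ}, overlapArea {w : ℂ | ‖w‖ ≤ ρ} z =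
      2 * Real.pi * (8 * ρ ^ 4 * (3 * Real.pi / 32 - 1 / 8)) / 2 := by
  set g : ℝ → ℝ := fun u => u * (Real.pi / 2 - u * √(1 - u ^ 2) - Real.arcsin u) with hg
  set f : ℝ → ℝ := fun x => 2 * ρ ^ 2 * (Real.pi / 2 -
      x / (√2 * ρ) * √(1 - (x / (√2 * ρ)) ^ 2) - Real.arcsin (x / (√2 * ρ))) with hf
  have h2 : √2 * √2 = (2 : ℝ) := Real.mul_self_sqrt (by norm_num)
  have hs2 : (0 : ℝ) < √2 := by positivity
  have hm : MeasurableSet {w : ℂ | ‖w‖ ≤ ρ} := measurableSet_le (by fun_prop) (by fun_prop)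
  have h1 : ∫ z in {w : ℂ | ‖w‖ ≤ ρ}, overlapArea {w : ℂ | ‖w‖ ≤ ρ} z =
      ∫ z : ℂ, (Iic ρ).indicator f ‖z‖ := by
    rw [setIntegral_congr_fun hm fun z hz => overlapArea_disk hρ hz, ← integral_indicator hm]
    rfl
  have h3 : ∫ y in Ioi (0 : ℝ), y ^ (Module.finrank ℝ ℂ - 1) • (Iic ρ).indicator f y =
      ∫ y in (0 : ℝ)..ρ, 2 * ρ ^ 2 * (√2 * ρ) * g (y / (√2 * ρ)) := by
    rw [intervalIntegral.integral_of_le hρ.le, ← Ioi_inter_Iic, ← integral_indicator measurableSet_Ioi,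
      ← integral_indicator (measurableSet_Ioi.inter measurableSet_Iic)]
    congr 1
    funext y
    rw [Complex.finrank_real_complex]
    by_cases hy0 : y ∈ Ioi (0 : ℝ) <;> by_cases hy1 : y ∈ Iic ρ
    · rw [indicator_of_mem hy0, indicator_of_mem hy1, indicator_of_mem (show y ∈ Ioi 0 ∩ Iic ρ from ⟨hy0, hy1⟩)]
      simp only [hg, hf, smul_eq_mul]
      field_simp
      ring
    · rw [indicator_of_mem hy0, indicator_of_notMem hy1, indicator_of_notMem fun h => hy1 h.2]
      simp
    · rw [indicator_of_notMem hy0, indicator_of_notMem fun h => hy0 h.1]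
    · rw [indicator_of_notMem hy0, indicator_of_notMem fun h => hy0 h.1]
  have hball : volume.real (Metric.ball (0 : ℂ) 1) = Real.pi := by
    rw [Measure.real, Complex.volume_ball]
    simp
  rw [h1, integral_fun_norm_addHaar volume ((Iic ρ).indicator f), h3, hball,
    intervalIntegral.integral_const_mul, intervalIntegral.integral_comp_div g (by positivity),
    Complex.finrank_real_complex, zero_div,
    show ρ / (√2 * ρ) = √2 / 2 by field_simp; rw [Real.sq_sqrt]; norm_num, integral_mul_lens]
  simp only [smul_eq_mul, nsmul_eq_mul]
  push_cast
  linear_combination (4 * Real.pi * ρ ^ 4 * (3 * Real.pi / 32 - 1 / 8)) * h2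

lemma integral_overlapArea_unitAreaDisk :
    ∫ z in unitAreaDisk, overlapArea unitAreaDisk z = 3 / 4 - 1 / Real.pi := by
  have h := integral_overlapArea_disk (ρ := 1 / √Real.pi) (by positivity)
  rw [show (1 / √Real.pi) ^ 4 = ((1 / √Real.pi) ^ 2) ^ 2 by ring, sq_one_div_sqrt_pi] at h
  refine h.trans ?_
  have := Real.pi_pos
  field_simp
  ring

theorem theorem2 :
    (∀ K : Set ℂ, IsCompact K → volume K = 1 → perimeter K < ⊤ →
      IntegrableOn (overlapArea K) K ∧
      TriangleAsymptotics K (∫ z in K, overlapArea K z)) ∧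
    ((∫ z in unitAreaSquare, overlapArea unitAreaSquare z) = 5 / 12 ∧
      TriangleAsymptotics unitAreaSquare (5 / 12)) ∧
    ((∫ z in unitAreaDisk, overlapArea unitAreaDisk z) = 3 / 4 - 1 / Real.pi ∧
      TriangleAsymptotics unitAreaDisk (3 / 4 - 1 / Real.pi)) := by
  refine ⟨fun K hK h1 hp => ⟨integrableOn_overlapArea hK hp,
    triangleAsymptotics_of_perimeter_lt_top hK h1 hp⟩,
    ⟨integral_overlapArea_unitAreaSquare, ?_⟩, integral_overlapArea_unitAreaDisk, ?_⟩
  · rw [← integral_overlapArea_unitAreaSquare]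
    exact triangleAsymptotics_of_perimeter_lt_top isCompact_unitAreaSquare volume_unitAreaSquare
      perimeter_unitAreaSquare_lt_top
  · rw [← integral_overlapArea_unitAreaDisk]
    exact triangleAsymptotics_of_perimeter_lt_top isCompact_unitAreaDisk volume_unitAreaDisk
      perimeter_unitAreaDisk_lt_top
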